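/- Let $N\ge 1$ and let $\Omega\subset\mathbb R^N$ be a bounded domain with $C^{1,1}$ boundary. Put $$c_N=\pi^{-N/2}\Gamma(N/2),\qquad \rho_N=2\ln 2+\psi(N/2)-\gamma,$$ where $\psi=\Gamma'/\Gamma$ and $\gamma$ is the Euler–Mascheroni constant, and let $k(z)=\mathbf 1_{B_1}(z)|z|^{-N}$, $j(z)=\mathbf 1_{\mathbb R^N\setminus B_1}(z)|z|^{-N}$. Let $\mathbb H(\Omega)$ be the space of all $u\in L^2(\mathbb R^N)$ with $u=0$ a.e. in $\mathbb R^N\setminus\Omega$ and $\iint |u(x)-u(y)|^2k(x-y)\,dx\,dy<\infty$, with inner product and norm $$\mathcal E(u,v)=\frac{c_N}{2}\iint (u(x)-u(y))(v(x)-v(y))k(x-y)\,dx\,dy,\qquad \|u\|=\mathcal E(u,u)^{1/2}.$$ The quadratic form of the logarithmic Laplacian $L_\Delta$ is $$\mathcal E_L(u,v)=\mathcal E(u,v)-c_N\iint u(x)v(y)j(x-y)\,dx\,dy+\rho_N\int_{\mathbb R^N} uv\,dx .$$ Let $I(u)=\int_\Omega u^2\,dx$, $\mathcal P=\{u\in\mathbb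 H(\Omega): I(u)=1\}$ and $\lambda_1^L=\inf_{u\in\mathcal P}\mathcal E_L(u,u)$. With $u^\pm=\max\{\pm u,0\}$, the Fučík spectrum $\Sigma_L$ is the set of all $(\alpha,\beta)\in\mathbb R^2$ for which there is $u\in\mathbb H(\Omega)$, $u\not\equiv0$, with $$\mathcal E_L(u,v)=\alpha\int_\Omega u^+v\,dx-\beta\int_\Omega u^-v\,dx\qquad\text{for all } v\in\mathbb H(\Omega).$$ For $r\in\mathbb R$ let $E_r(u)=\mathcal E_L(u,u)-r\int_\Omega (u^+)^2\,dx$ on $\mathbb H(\Omega)$, and let $\tilde E_r$ be the restriction of $E_r$ to $\mathcal P$; $u\in\mathcal P$ is a critical point of $\tilde E_r$ if $E_r'(u)=t\,I'(u)$ in the dual of $\mathbb H(\Omega)$ for some $t\in\mathbb R$. A first eigenfunction is a function $\varphi_1\in\mathcal P$ with $\varphi_1\ge0$ a.e. and $\mathcal E_L(\varphi_1,v)=\lambda_1^L\int_\Omega\varphi_1v\,dx$ for all $v\in\mathbb H(\Omega)$. **Proposition.** A first eigenfunction exists, and for every first eigenfunction $\varphi_1$ and every $r\in\mathbb R$, the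 function $-\varphi_1$ is a critical point of $\tilde E_r$, different from $\varphi_1$, such that 1. $-\varphi_1$ is a strict local minimum of $\tilde E_r$ (on $\mathcal P$ with respect to the norm $\|\cdot\|$), and 2. $\tilde E_r(-\varphi_1)=\lambda_1^L$. Moreover $(\lambda_1^L+r,\lambda_1^L)\in\Sigma_L$ for every $r\in\mathbb R$; that is, the horizontal line $\mathbb R\times\{\lambda_1^L\}$ lies in $\Sigma_L$. -/

import Mathlib

open MeasureTheory Set Filter Topology

namespace LogLaplacian

noncomputable section

/-- A bounded domain (nonempty, open, connected) of `ℝ^N` whose boundary is of class `C^{1,1}`: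
near every boundary point, `Ω` is, in the direction of some unit vector `e`, the strict
supergraph of a function `g` with Lipschitz gradient, evaluated at the component of `x`
orthogonal to `e`. -/
structure IsBoundedC11Domain {N : ℕ} (Ω : Set (EuclideanSpace ℝ (Fin N))) : Prop where
  isOpen : IsOpen Ω
  isConnected : IsConnected Ω
  isBounded : Bornology.IsBounded Ω
  boundary : ∀ x₀ ∈ frontier Ω,
    ∃ e : EuclideanSpace ℝ (Fin N), ‖e‖ = 1 ∧
    ∃ ρ : ℝ, 0 < ρ ∧
    ∃ g : EuclideanSpace ℝ (Fin N) → ℝ,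
      ContDiff ℝ 1 g ∧ (∃ K, LipschitzWith K (fderiv ℝ g)) ∧
      ∀ x ∈ Metric.ball x₀ ρ,
        (x ∈ Ω ↔ g (x - (inner ℝ e x) • e) < inner ℝ e x)

/-- `c_N = π^{-N/2} Γ(N/2)`. -/
def cN (N : ℕ) : ℝ := Real.pi ^ (-(N : ℝ) / 2) * Real.Gamma ((N : ℝ) / 2)

/-- `ρ_N = 2 ln 2 + ψ(N/2) - γ`, with `ψ = Γ'/Γ` and `γ` the Euler-Mascheroni constant. -/
def rhoN (N : ℕ) : ℝ :=
  2 * Real.log 2 + deriv Real.Gamma ((N : ℝ) / 2) / Real.Gamma ((N : ℝ) / 2)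
    - Real.eulerMascheroniConstant

/-- `k(z) = 1_{B_1}(z) / |z|^N`. -/
def kerK {N : ℕ} : EuclideanSpace ℝ (Fin N) → ℝ :=
  indicator (Metric.ball 0 1) (fun z => 1 / ‖z‖ ^ N)

/-- `j(z) = 1_{ℝ^N \ B_1}(z) / |z|^N`. -/
def kerJ {N : ℕ} : EuclideanSpace ℝ (Fin N) → ℝ :=
  indicator (Metric.ball 0 1)ᶜ (fun z => 1 / ‖z‖ ^ N)

/-- The energy space `ℍ(Ω)`: square integrable functions on `ℝ^N` that vanish (almost everywhere)
outside `Ω` and have finite energy. Its elements are handled through representatives, so that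
equality in `ℍ(Ω)` is equality almost everywhere. -/
def energySpace {N : ℕ} (Ω : Set (EuclideanSpace ℝ (Fin N))) :
    Set (EuclideanSpace ℝ (Fin N) → ℝ) :=
  {u | MemLp u 2 volume ∧ (∀ᵐ x, x ∉ Ω → u x = 0) ∧
    Integrable (fun p : EuclideanSpace ℝ (Fin N) × EuclideanSpace ℝ (Fin N) =>
      (u p.1 - u p.2) ^ 2 * kerK (p.1 - p.2)) (volume.prod volume)}

/-- The inner product `ℰ(u,v)` of `ℍ(Ω)`. -/
def formE {N : ℕ} (u v : EuclideanSpace ℝ (Fin N) → ℝ) : ℝ :=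
  cN N / 2 * ∫ p : EuclideanSpace ℝ (Fin N) × EuclideanSpace ℝ (Fin N),
    (u p.1 - u p.2) * (v p.1 - v p.2) * kerK (p.1 - p.2) ∂(volume.prod volume)

/-- The norm `‖u‖ = ℰ(u,u)^{1/2}` of `ℍ(Ω)`. -/
def normE {N : ℕ} (u : EuclideanSpace ℝ (Fin N) → ℝ) : ℝ := Real.sqrt (formE u u)

/-- The quadratic form `ℰ_L(u,v)` of the logarithmic Laplacian. -/
def formEL {N : ℕ} (u v : EuclideanSpace ℝ (Fin N) → ℝ) : ℝ :=
  formE u v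
    - cN N * (∫ p : EuclideanSpace ℝ (Fin N) × EuclideanSpace ℝ (Fin N),
        u p.1 * v p.2 * kerJ (p.1 - p.2) ∂(volume.prod volume))
    + rhoN N * ∫ x, u x * v x

/-- `I(u) = ∫_Ω u²`. -/
def massI {N : ℕ} (Ω : Set (EuclideanSpace ℝ (Fin N))) (u : EuclideanSpace ℝ (Fin N) → ℝ) : ℝ :=
  ∫ x in Ω, u x ^ 2

/-- The constraint set `𝒫 = {u ∈ ℍ(Ω) : I(u) = 1}`. -/
def sphereP {N : ℕ} (Ω : Set (EuclideanSpace ℝ (Fin N))) :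
    Set (EuclideanSpace ℝ (Fin N) → ℝ) :=
  {u | u ∈ energySpace Ω ∧ massI Ω u = 1}

/-- The first eigenvalue `λ₁^L = inf {ℰ_L(u,u) : u ∈ ℍ(Ω), ‖u‖₂ = 1}`. -/
def lambda1 {N : ℕ} (Ω : Set (EuclideanSpace ℝ (Fin N))) : ℝ :=
  sInf ((fun u => formEL u u) '' sphereP Ω)

/-- `u` is a weak solution of `L_Δ u = α u⁺ - β u⁻` in `Ω`, `u = 0` in `ℝ^N \ Ω`. -/
def IsWeakSolution {N : ℕ} (Ω : Set (EuclideanSpace ℝ (Fin N))) (α β : ℝ)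
    (u : EuclideanSpace ℝ (Fin N) → ℝ) : Prop :=
  u ∈ energySpace Ω ∧ ∀ v ∈ energySpace Ω,
    formEL u v = α * (∫ x in Ω, max (u x) 0 * v x) - β * ∫ x in Ω, max (-u x) 0 * v x

/-- The Fučík spectrum `Σ_L`: all `(α, β)` for which there is a nontrivial weak solution. -/
def fucikSpectrum {N : ℕ} (Ω : Set (EuclideanSpace ℝ (Fin N))) : Set (ℝ × ℝ) :=
  {p | ∃ u, IsWeakSolution Ω p.1 p.2 u ∧ ¬ (u =ᵐ[volume] 0)}

/-- `φ` is a (nonnegative, `L²`-normalized) first eigenfunction: a weak solution of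
`L_Δ φ = λ₁^L φ` in `Ω`, `φ = 0` in `ℝ^N \ Ω`. -/
def IsFirstEigenfunction {N : ℕ} (Ω : Set (EuclideanSpace ℝ (Fin N)))
    (φ : EuclideanSpace ℝ (Fin N) → ℝ) : Prop :=
  φ ∈ sphereP Ω ∧
  (∀ v ∈ energySpace Ω, formEL φ v = lambda1 Ω * ∫ x in Ω, φ x * v x) ∧
  ∀ᵐ x, 0 ≤ φ x

/-- `E_r(u) = ℰ_L(u,u) - r ∫_Ω (u⁺)²`. -/
def energyE {N : ℕ} (Ω : Set (EuclideanSpace ℝ (Fin N))) (r : ℝ)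
    (u : EuclideanSpace ℝ (Fin N) → ℝ) : ℝ :=
  formEL u u - r * ∫ x in Ω, max (u x) 0 ^ 2

/-- The Fréchet derivative at `u` of the functional `F` on the normed space `(ℍ(Ω), ‖·‖)`
exists and is zero. -/
def HasZeroFrechetDerivAt {N : ℕ} (Ω : Set (EuclideanSpace ℝ (Fin N)))
    (F : (EuclideanSpace ℝ (Fin N) → ℝ) → ℝ) (u : EuclideanSpace ℝ (Fin N) → ℝ) : Prop :=
  ∀ ε : ℝ, 0 < ε → ∃ δ : ℝ, 0 < δ ∧ ∀ v ∈ energySpace Ω, normE v < δ →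
    |F (u + v) - F u| ≤ ε * normE v

/-- `u` is a critical point of the restriction `Ẽ_r` of `E_r` to `𝒫`: `u ∈ 𝒫`, and
`E_r'(u) = t I'(u)` in the dual of `ℍ(Ω)` for some `t ∈ ℝ`, that is, `(E_r - t I)'(u) = 0`
(both functionals are `C¹`). -/
def IsCriticalPoint {N : ℕ} (Ω : Set (EuclideanSpace ℝ (Fin N))) (r : ℝ)
    (u : EuclideanSpace ℝ (Fin N) → ℝ) : Prop :=
  u ∈ sphereP Ω ∧
  ∃ t : ℝ, HasZeroFrechetDerivAt Ω (fun w => energyE Ω r w - t * massI Ω w) u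

/-- `u` is a strict local minimum of the restriction `Ẽ_r` of `E_r` to `𝒫`, with respect to the
norm of `ℍ(Ω)`. -/
def IsStrictLocalMinimum {N : ℕ} (Ω : Set (EuclideanSpace ℝ (Fin N))) (r : ℝ)
    (u : EuclideanSpace ℝ (Fin N) → ℝ) : Prop :=
  u ∈ sphereP Ω ∧
  ∃ ε : ℝ, 0 < ε ∧ ∀ w ∈ sphereP Ω, normE (w - u) < ε → ¬ (w =ᵐ[volume] u) →
    energyE Ω r u < energyE Ω r w

end

end LogLaplacian

namespace LogLaplacian

/-! Everything rests on the shifted form B(u,v) = ℰ_L(u,v) - λ₁∫uv (`formB`), which is nonnegative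
on ℍ(Ω) by the definition of λ₁, and on two properties of the kernels.

Sign. If a, b ≥ 0 have disjoint supports, the increments in ℰ and the minus sign before j combine
into B(a,b) = -c_N ∬ a(x)b(y)|x-y|^{-N}, with a kernel positive off the diagonal
(`formB_eq_of_disjoint`). Hence B(u,u) = B(u⁺,u⁺) + B(u⁻,u⁻) plus a nonnegative interaction term,
and any zero of B has constant sign (`posPart_eq_zero_or`). This makes minimizers signed and the
first eigenfunction φ unique; comparison with a multiple of the distance function gives φ > 0 a.e.
in Ω (`IsFirstEigenfunction.ae_pos`).

Singularity. Since k is not integrable at 0, the integrals of k_n = min(k,n) are unbounded in n,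
while ℰ_L(u,u) ≥ (c_N∫k_n + ρ_N)‖u‖₂² minus a form with bounded kernel (`formEL_ge_truncated`). This
bounds ℰ_L below on 𝒫, prevents loss of mass in weak limits of minimizing sequences
(`exists_minimizer`), and gives ℰ_L(u,u) ≥ M‖u‖₂² whenever u lives on a set of measure at most η(M)
(`exists_small_support_coercive`).

Strict minimality: if w ∈ 𝒫 is close to -φ, positivity of φ, Chebyshev and Poincaré make {w > 0}
small. If w⁺ ≠ 0, then E_r(w) - λ₁ ≥ B(w⁺,w⁺) - r∫(w⁺)² > 0 by small-support coercivity. If w⁺ = 0,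
then E_r(w) - λ₁ = B(w,w), which is positive unless w = -φ by uniqueness. Criticality holds with
multiplier λ₁ because B(φ,·) = 0 and (v-φ)⁺ ≤ |v|. Since (-φ)⁺ = 0, the first Fučík coordinate is
arbitrary. -/

/-- Abbreviation for `ℝ^N`. -/
abbrev V (N : ℕ) := EuclideanSpace ℝ (Fin N)

variable {N : ℕ} {Ω : Set (V N)}

/-! ### The kernels -/

lemma kerK_nonneg (z : V N) : 0 ≤ kerK z :=
  indicator_nonneg (fun _ _ => by positivity) z

lemma kerJ_nonneg (z : V N) : 0 ≤ kerJ z :=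
  indicator_nonneg (fun _ _ => by positivity) z

lemma kerJ_le_one (z : V N) : kerJ z ≤ 1 := by
  refine indicator_apply_le' (fun hz => ?_) (fun _ => zero_le_one)
  have h1 : 1 ≤ ‖z‖ := by simpa using hz
  rw [div_le_one (by positivity)]
  exact one_le_pow₀ h1

lemma abs_kerJ_le_one (z : V N) : |kerJ z| ≤ 1 := by
  rw [abs_of_nonneg (kerJ_nonneg z)]; exact kerJ_le_one z

lemma kerK_neg (z : V N) : kerK (-z) = kerK z := by
  simp [kerK, indicator]

lemma kerJ_neg (z : V N) : kerJ (-z) = kerJ z := by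
  simp [kerJ, indicator]

lemma measurable_kerK : Measurable (kerK : V N → ℝ) := by
  unfold kerK
  exact Measurable.indicator (by fun_prop) measurableSet_ball

lemma measurable_kerJ : Measurable (kerJ : V N → ℝ) := by
  unfold kerJ
  exact Measurable.indicator (by fun_prop) measurableSet_ball.compl

lemma kerK_add_kerJ (z : V N) : kerK z + kerJ z = 1 / ‖z‖ ^ N := by
  by_cases hz : z ∈ Metric.ball (0 : V N) 1
  · simp [kerK, kerJ, hz]
  · simp only [kerK, kerJ, indicator_of_notMem hz, indicator_of_mem (mem_compl hz), zero_add]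

lemma kerK_add_kerJ_pos {z : V N} (hz : z ≠ 0) : 0 < kerK z + kerJ z := by
  rw [kerK_add_kerJ]
  have : 0 < ‖z‖ := norm_pos_iff.2 hz
  positivity

lemma cN_pos (hN : 1 ≤ N) : 0 < cN N := by
  have : (0 : ℝ) < N := by exact_mod_cast hN
  exact mul_pos (Real.rpow_pos_of_pos Real.pi_pos _) (Real.Gamma_pos_of_pos (by positivity))

/-! ### Bilinear forms given by a kernel -/

/-- `∫∫ u(x) v(y) κ(x - y) dx dy`. -/
noncomputable def crossForm (κ : V N → ℝ) (u v : V N → ℝ) : ℝ :=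
  ∫ p : V N × V N, u p.1 * v p.2 * κ (p.1 - p.2) ∂(volume.prod volume)

/-- `∫∫ (u(x) - u(y)) (v(x) - v(y)) κ(x - y) dx dy`. -/
noncomputable def diffForm (κ : V N → ℝ) (u v : V N → ℝ) : ℝ :=
  ∫ p : V N × V N, (u p.1 - u p.2) * (v p.1 - v p.2) * κ (p.1 - p.2) ∂(volume.prod volume)

lemma formEL_eq (u v : V N → ℝ) :
    formEL u v = cN N / 2 * diffForm kerK u v - cN N * crossForm kerJ u v
      + rhoN N * ∫ x, u x * v x := rfl

lemma crossForm_symm {κ : V N → ℝ} (hκ : ∀ z, κ (-z) = κ z) (u v : V N → ℝ) :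
    crossForm κ u v = crossForm κ v u := by
  unfold crossForm
  rw [← integral_prod_swap]
  refine integral_congr_ae (Eventually.of_forall fun p => ?_)
  simp only [Prod.fst_swap, Prod.snd_swap]
  rw [← hκ, neg_sub]; ring

lemma diffForm_symm (κ : V N → ℝ) (u v : V N → ℝ) : diffForm κ u v = diffForm κ v u := by
  unfold diffForm
  congr 1; ext p; ring

lemma formEL_symm (u v : V N → ℝ) : formEL u v = formEL v u := by
  rw [formEL_eq, formEL_eq, diffForm_symm, crossForm_symm kerJ_neg]
  simp_rw [mul_comm (u _)]

lemma aestronglyMeasurable_kernel {κ : V N → ℝ} (hκ : Measurable κ) :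
    AEStronglyMeasurable (fun p : V N × V N => κ (p.1 - p.2)) (volume.prod volume) :=
  (hκ.comp (measurable_fst.sub measurable_snd)).aestronglyMeasurable

lemma aestronglyMeasurable_cross {κ : V N → ℝ} (hκ : Measurable κ) {u v : V N → ℝ}
    (hu : AEStronglyMeasurable u volume) (hv : AEStronglyMeasurable v volume) :
    AEStronglyMeasurable (fun p : V N × V N => u p.1 * v p.2 * κ (p.1 - p.2))
      (volume.prod volume) :=
  (hu.comp_fst.mul hv.comp_snd).mul (aestronglyMeasurable_kernel hκ)

lemma aestronglyMeasurable_diff {κ : V N → ℝ} (hκ : Measurable κ) {u v : V N → ℝ}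
    (hu : AEStronglyMeasurable u volume) (hv : AEStronglyMeasurable v volume) :
    AEStronglyMeasurable (fun p : V N × V N => (u p.1 - u p.2) * (v p.1 - v p.2) * κ (p.1 - p.2))
      (volume.prod volume) :=
  ((hu.comp_fst.sub hu.comp_snd).mul (hv.comp_fst.sub hv.comp_snd)).mul
    (aestronglyMeasurable_kernel hκ)

lemma integrable_cross_of_bounded {κ : V N → ℝ} (hκ : Measurable κ) {C : ℝ}
    (hC : ∀ z, |κ z| ≤ C) {u v : V N → ℝ} (hu : Integrable u) (hv : Integrable v) :
    Integrable (fun p : V N × V N => u p.1 * v p.2 * κ (p.1 - p.2)) (volume.prod volume) :=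
  (hu.mul_prod hv).mul_bdd (c := C) (aestronglyMeasurable_kernel hκ)
    (Eventually.of_forall fun _ => hC _)

/-! ### The energy space -/

lemma integrable_of_mem (hΩ : IsBoundedC11Domain Ω) {u : V N → ℝ} (hu : MemLp u 2 volume)
    (h0 : ∀ᵐ x, x ∉ Ω → u x = 0) : Integrable u := by
  have : Fact (volume Ω < ⊤) := ⟨hΩ.isBounded.measure_lt_top⟩
  have h1 : IntegrableOn u Ω := (hu.restrict Ω).integrable (by norm_num)
  exact h1.integrable_of_ae_notMem_eq_zero h0

lemma integrable_diff {u v : V N → ℝ} (hu : u ∈ energySpace Ω) (hv : v ∈ energySpace Ω) :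
    Integrable (fun p : V N × V N => (u p.1 - u p.2) * (v p.1 - v p.2) * kerK (p.1 - p.2))
      (volume.prod volume) := by
  refine (hu.2.2.add hv.2.2).mono' (aestronglyMeasurable_diff measurable_kerK hu.1.1 hv.1.1)
    (Eventually.of_forall fun p => ?_)
  have hk := kerK_nonneg (p.1 - p.2)
  simp only [Pi.add_apply]
  rw [Real.norm_eq_abs, abs_mul, abs_of_nonneg hk, ← add_mul]
  refine mul_le_mul_of_nonneg_right ?_ hk
  rw [abs_le]
  constructor <;> nlinarith [sq_nonneg (u p.1 - u p.2 + (v p.1 - v p.2)),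
    sq_nonneg (u p.1 - u p.2 - (v p.1 - v p.2)), sq_nonneg (u p.1 - u p.2),
    sq_nonneg (v p.1 - v p.2)]

/-- A function dominated, together with its increments, by functions of the energy space. -/
lemma mem_energySpace_of_le {u v w : V N → ℝ} (hu : u ∈ energySpace Ω) (hv : v ∈ energySpace Ω)
    (hw : MemLp w 2 volume) (hw0 : ∀ᵐ x, x ∉ Ω → w x = 0) {C : ℝ}
    (hle : ∀ x y, |w x - w y| ≤ C * (|u x - u y| + |v x - v y|)) : w ∈ energySpace Ω := by
  refine ⟨hw, hw0, ?_⟩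
  refine ((hu.2.2.add hv.2.2).const_mul (2 * C ^ 2)).mono' ?_ (Eventually.of_forall fun p => ?_)
  · exact ((hw.1.comp_fst.sub hw.1.comp_snd).pow 2).mul (aestronglyMeasurable_kernel measurable_kerK)
  · have hk := kerK_nonneg (p.1 - p.2)
    simp only [Pi.add_apply]
    rw [Real.norm_eq_abs, abs_mul, abs_of_nonneg hk, ← add_mul, ← mul_assoc]
    refine mul_le_mul_of_nonneg_right ?_ hk
    rw [abs_of_nonneg (sq_nonneg _), ← sq_abs (w _ - w _), ← sq_abs (u _ - u _),
      ← sq_abs (v _ - v _)]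
    calc |w p.1 - w p.2| ^ 2 ≤ (C * (|u p.1 - u p.2| + |v p.1 - v p.2|)) ^ 2 := by
          gcongr; exact hle _ _
      _ = C ^ 2 * (|u p.1 - u p.2| + |v p.1 - v p.2|) ^ 2 := by ring
      _ ≤ C ^ 2 * (2 * (|u p.1 - u p.2| ^ 2 + |v p.1 - v p.2| ^ 2)) := by
          gcongr
          exact add_sq_le
      _ = _ := by ring

lemma add_smul_mem {u v : V N → ℝ} (hu : u ∈ energySpace Ω) (hv : v ∈ energySpace Ω) (c : ℝ) :
    u + c • v ∈ energySpace Ω := by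
  refine mem_energySpace_of_le hu hv (hu.1.add (hv.1.const_smul c)) ?_ (C := 1 + |c|)
    (fun x y => ?_)
  · filter_upwards [hu.2.1, hv.2.1] with x h1 h2 hx
    simp [h1 hx, h2 hx]
  · simp only [Pi.add_apply, Pi.smul_apply, smul_eq_mul]
    calc |u x + c * v x - (u y + c * v y)| = |(u x - u y) + c * (v x - v y)| := by ring_nf
      _ ≤ |u x - u y| + |c| * |v x - v y| := by
          rw [← abs_mul]; exact abs_add_le _ _
      _ ≤ _ := by nlinarith [abs_nonneg (u x - u y), abs_nonneg (v x - v y), abs_nonneg c]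

lemma zero_mem_energySpace : (0 : V N → ℝ) ∈ energySpace Ω := by
  refine ⟨MemLp.zero, by simp, by simp⟩

lemma smul_mem {u : V N → ℝ} (hu : u ∈ energySpace Ω) (c : ℝ) : c • u ∈ energySpace Ω := by
  simpa using add_smul_mem zero_mem_energySpace hu c

lemma neg_mem {u : V N → ℝ} (hu : u ∈ energySpace Ω) : -u ∈ energySpace Ω := by
  simpa using smul_mem hu (-1)

lemma sub_mem {u v : V N → ℝ} (hu : u ∈ energySpace Ω) (hv : v ∈ energySpace Ω) :
    u - v ∈ energySpace Ω := by
  simpa [sub_eq_add_neg] using add_smul_mem hu hv (-1)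

/-- The positive part of a function. -/
def posPart (u : V N → ℝ) : V N → ℝ := fun x => max (u x) 0

lemma posPart_nonneg (u : V N → ℝ) (x : V N) : 0 ≤ posPart u x := le_max_right _ _

lemma posPart_sub_posPart_neg (u : V N → ℝ) : posPart u + (-1 : ℝ) • posPart (-u) = u := by
  ext x
  simp only [posPart, Pi.add_apply, Pi.smul_apply, Pi.neg_apply, smul_eq_mul]
  rcases le_total (u x) 0 with h | h
  · rw [max_eq_right h, max_eq_left (by linarith)]; ring
  · rw [max_eq_left h, max_eq_right (by linarith)]; ring

lemma posPart_mul_posPart_neg (u : V N → ℝ) (x : V N) : posPart u x * posPart (-u) x = 0 := by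
  simp only [posPart, Pi.neg_apply]
  rcases le_total (u x) 0 with h | h
  · rw [max_eq_right h, zero_mul]
  · rw [max_eq_right (b := (0 : ℝ)) (a := -u x) (by linarith), mul_zero]

lemma memLp_posPart {u : V N → ℝ} (hu : MemLp u 2 volume) : MemLp (posPart u) 2 volume := by
  refine hu.of_le (hu.1.sup aestronglyMeasurable_const) (Eventually.of_forall fun x => ?_)
  rw [Real.norm_eq_abs, Real.norm_eq_abs, abs_of_nonneg (posPart_nonneg u x)]
  exact max_le (le_abs_self _) (abs_nonneg _)

lemma posPart_mem {u : V N → ℝ} (hu : u ∈ energySpace Ω) : posPart u ∈ energySpace Ω := by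
  refine mem_energySpace_of_le hu hu (memLp_posPart hu.1) ?_ (C := 1) (fun x y => ?_)
  · filter_upwards [hu.2.1] with x h hx
    simp [posPart, h hx]
  · have := abs_max_sub_max_le_abs (u x) (u y) 0
    simp only [posPart]
    linarith [abs_nonneg (u x - u y)]

lemma massI_eq {u : V N → ℝ} (h0 : ∀ᵐ x, x ∉ Ω → u x = 0) : massI Ω u = ∫ x, u x ^ 2 := by
  refine setIntegral_eq_integral_of_ae_compl_eq_zero ?_
  filter_upwards [h0] with x h hx
  simp [h hx]

lemma setIntegral_mul_eq {u v : V N → ℝ} (h0 : ∀ᵐ x, x ∉ Ω → v x = 0) :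
    ∫ x in Ω, u x * v x = ∫ x, u x * v x := by
  refine setIntegral_eq_integral_of_ae_compl_eq_zero ?_
  filter_upwards [h0] with x h hx
  simp [h hx]

lemma integrable_mul_of_memLp {u v : V N → ℝ} (hu : MemLp u 2 volume) (hv : MemLp v 2 volume) :
    Integrable (fun x => u x * v x) := hu.integrable_mul hv

/-! ### Bilinearity -/

lemma crossForm_add_smul {κ : V N → ℝ} {u v w : V N → ℝ} (c : ℝ)
    (hu : Integrable (fun p : V N × V N => u p.1 * w p.2 * κ (p.1 - p.2)) (volume.prod volume))
    (hv : Integrable (fun p : V N × V N => v p.1 * w p.2 * κ (p.1 - p.2)) (volume.prod volume)) :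
    crossForm κ (u + c • v) w = crossForm κ u w + c * crossForm κ v w := by
  unfold crossForm
  rw [← integral_const_mul, ← integral_add hu (hv.const_mul c)]
  congr 1; ext p
  simp only [Pi.add_apply, Pi.smul_apply, smul_eq_mul]; ring

lemma diffForm_add_smul {κ : V N → ℝ} {u v w : V N → ℝ} (c : ℝ)
    (hu : Integrable (fun p : V N × V N => (u p.1 - u p.2) * (w p.1 - w p.2) * κ (p.1 - p.2))
      (volume.prod volume))
    (hv : Integrable (fun p : V N × V N => (v p.1 - v p.2) * (w p.1 - w p.2) * κ (p.1 - p.2))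
      (volume.prod volume)) :
    diffForm κ (u + c • v) w = diffForm κ u w + c * diffForm κ v w := by
  unfold diffForm
  rw [← integral_const_mul, ← integral_add hu (hv.const_mul c)]
  congr 1; ext p
  simp only [Pi.add_apply, Pi.smul_apply, smul_eq_mul]; ring

lemma integral_mul_add_smul {u v w : V N → ℝ} (c : ℝ) (hu : MemLp u 2 volume)
    (hv : MemLp v 2 volume) (hw : MemLp w 2 volume) :
    ∫ x, (u + c • v) x * w x = (∫ x, u x * w x) + c * ∫ x, v x * w x := by
  rw [← integral_const_mul, ← integral_add (integrable_mul_of_memLp hu hw)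
    ((integrable_mul_of_memLp hv hw).const_mul c)]
  congr 1; ext p
  simp only [Pi.add_apply, Pi.smul_apply, smul_eq_mul]; ring

lemma integrable_cross_kerJ (hΩ : IsBoundedC11Domain Ω) {u v : V N → ℝ}
    (hu : u ∈ energySpace Ω) (hv : v ∈ energySpace Ω) :
    Integrable (fun p : V N × V N => u p.1 * v p.2 * kerJ (p.1 - p.2)) (volume.prod volume) :=
  integrable_cross_of_bounded measurable_kerJ
    abs_kerJ_le_one
    (integrable_of_mem hΩ hu.1 hu.2.1) (integrable_of_mem hΩ hv.1 hv.2.1)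

lemma formEL_add_smul (hΩ : IsBoundedC11Domain Ω) {u v w : V N → ℝ} (hu : u ∈ energySpace Ω)
    (hv : v ∈ energySpace Ω) (hw : w ∈ energySpace Ω) (c : ℝ) :
    formEL (u + c • v) w = formEL u w + c * formEL v w := by
  simp only [formEL_eq]
  rw [diffForm_add_smul c (integrable_diff hu hw) (integrable_diff hv hw),
    crossForm_add_smul c (integrable_cross_kerJ hΩ hu hw) (integrable_cross_kerJ hΩ hv hw),
    integral_mul_add_smul c hu.1 hv.1 hw.1]
  ring

/-- The shifted form `ℰ_L(u,v) - λ₁ ∫ u v`. -/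
noncomputable def formB (Ω : Set (V N)) (u v : V N → ℝ) : ℝ :=
  formEL u v - lambda1 Ω * ∫ x, u x * v x

lemma formB_symm (u v : V N → ℝ) : formB Ω u v = formB Ω v u := by
  unfold formB
  rw [formEL_symm]
  simp_rw [mul_comm (u _)]

lemma formB_add_smul (hΩ : IsBoundedC11Domain Ω) {u v w : V N → ℝ} (hu : u ∈ energySpace Ω)
    (hv : v ∈ energySpace Ω) (hw : w ∈ energySpace Ω) (c : ℝ) :
    formB Ω (u + c • v) w = formB Ω u w + c * formB Ω v w := by
  unfold formB
  rw [formEL_add_smul hΩ hu hv hw, integral_mul_add_smul c hu.1 hv.1 hw.1]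
  ring

lemma formB_add_smul_self (hΩ : IsBoundedC11Domain Ω) {u v : V N → ℝ} (hu : u ∈ energySpace Ω)
    (hv : v ∈ energySpace Ω) (c : ℝ) :
    formB Ω (u + c • v) (u + c • v)
      = formB Ω u u + 2 * c * formB Ω u v + c ^ 2 * formB Ω v v := by
  have huv := add_smul_mem hu hv c
  rw [formB_add_smul hΩ hu hv huv, formB_symm u, formB_symm v, formB_add_smul hΩ hu hv hu,
    formB_add_smul hΩ hu hv hv, formB_symm v u]
  ring

lemma formEL_smul_smul (c : ℝ) (u : V N → ℝ) : formEL (c • u) (c • u) = c ^ 2 * formEL u u := by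
  have h1 : diffForm kerK (c • u) (c • u) = c ^ 2 * diffForm kerK u u := by
    unfold diffForm
    rw [← integral_const_mul]; congr 1; ext p; simp only [Pi.smul_apply, smul_eq_mul]; ring
  have h2 : crossForm kerJ (c • u) (c • u) = c ^ 2 * crossForm kerJ u u := by
    unfold crossForm
    rw [← integral_const_mul]; congr 1; ext p; simp only [Pi.smul_apply, smul_eq_mul]; ring
  have h3 : ∫ x, (c • u) x * (c • u) x = c ^ 2 * ∫ x, u x * u x := by
    rw [← integral_const_mul]; congr 1; ext p; simp only [Pi.smul_apply, smul_eq_mul]; ring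
  rw [formEL_eq, formEL_eq, h1, h2, h3]; ring

/-! ### Functions with disjoint supports -/

/-- The full kernel `k + j`. -/
noncomputable def kerT (z : V N) : ℝ := kerK z + kerJ z

lemma kerT_nonneg (z : V N) : 0 ≤ kerT z := add_nonneg (kerK_nonneg z) (kerJ_nonneg z)

lemma measurable_kerT : Measurable (kerT : V N → ℝ) := measurable_kerK.add measurable_kerJ

lemma crossForm_nonneg {κ : V N → ℝ} (hκ : ∀ z, 0 ≤ κ z) {a b : V N → ℝ} (ha : ∀ x, 0 ≤ a x)
    (hb : ∀ x, 0 ≤ b x) : 0 ≤ crossForm κ a b :=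
  integral_nonneg fun p => mul_nonneg (mul_nonneg (ha p.1) (hb p.2)) (hκ _)

/-- For disjoint supports, a(x)b(y) + a(y)b(x) = -(a(x)-a(y))(b(x)-b(y)), so finite energy controls
the cross term despite the singularity of k. -/
lemma integrable_cross_kerK {a b : V N → ℝ} (ha : a ∈ energySpace Ω) (hb : b ∈ energySpace Ω)
    (ha0 : ∀ x, 0 ≤ a x) (hb0 : ∀ x, 0 ≤ b x) (hab : ∀ x, a x * b x = 0) :
    Integrable (fun p : V N × V N => a p.1 * b p.2 * kerK (p.1 - p.2)) (volume.prod volume) := by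
  refine (integrable_diff ha hb).mono (aestronglyMeasurable_cross measurable_kerK ha.1.1 hb.1.1)
    (Eventually.of_forall fun p => ?_)
  have hk := kerK_nonneg (p.1 - p.2)
  rw [Real.norm_eq_abs, Real.norm_eq_abs, abs_mul _ (kerK _), abs_mul _ (kerK _), abs_of_nonneg hk]
  refine mul_le_mul_of_nonneg_right ?_ hk
  have h1 : (a p.1 - a p.2) * (b p.1 - b p.2) = -(a p.1 * b p.2 + a p.2 * b p.1) := by
    linear_combination hab p.1 + hab p.2
  have h2 := mul_nonneg (ha0 p.1) (hb0 p.2)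
  have h3 := mul_nonneg (ha0 p.2) (hb0 p.1)
  rw [h1, abs_neg, abs_of_nonneg h2, abs_of_nonneg (add_nonneg h2 h3)]
  linarith

lemma integrable_cross_kerT (hΩ : IsBoundedC11Domain Ω) {a b : V N → ℝ}
    (ha : a ∈ energySpace Ω) (hb : b ∈ energySpace Ω)
    (ha0 : ∀ x, 0 ≤ a x) (hb0 : ∀ x, 0 ≤ b x) (hab : ∀ x, a x * b x = 0) :
    Integrable (fun p : V N × V N => a p.1 * b p.2 * kerT (p.1 - p.2)) (volume.prod volume) := by
  refine ((integrable_cross_kerK ha hb ha0 hb0 hab).add (integrable_cross_kerJ hΩ ha hb)).congr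
    (Eventually.of_forall fun p => ?_)
  simp only [Pi.add_apply, kerT]; ring

lemma diffForm_eq_of_disjoint {a b : V N → ℝ} (ha : a ∈ energySpace Ω) (hb : b ∈ energySpace Ω)
    (ha0 : ∀ x, 0 ≤ a x) (hb0 : ∀ x, 0 ≤ b x) (hab : ∀ x, a x * b x = 0) :
    diffForm kerK a b = -2 * crossForm kerK a b := by
  have h1 := integrable_cross_kerK ha hb ha0 hb0 hab
  have h2 := integrable_cross_kerK hb ha hb0 ha0 (fun x => by rw [mul_comm]; exact hab x)
  have h3 : diffForm kerK a b = -(crossForm kerK a b + crossForm kerK b a) := by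
    unfold diffForm crossForm
    rw [← integral_add h1 h2, ← integral_neg]
    congr 1; ext p
    linear_combination (kerK (p.1 - p.2)) * (hab p.1 + hab p.2)
  rw [h3, crossForm_symm kerK_neg b a]; ring

/-- The cross terms of k and j enter with the same sign, and the mass term vanishes since ab = 0. -/
lemma formEL_eq_of_disjoint (hΩ : IsBoundedC11Domain Ω) {a b : V N → ℝ}
    (ha : a ∈ energySpace Ω) (hb : b ∈ energySpace Ω)
    (ha0 : ∀ x, 0 ≤ a x) (hb0 : ∀ x, 0 ≤ b x) (hab : ∀ x, a x * b x = 0) :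
    formEL a b = -(cN N * crossForm kerT a b) := by
  have h1 : crossForm kerT a b = crossForm kerK a b + crossForm kerJ a b := by
    unfold crossForm
    rw [← integral_add (integrable_cross_kerK ha hb ha0 hb0 hab) (integrable_cross_kerJ hΩ ha hb)]
    congr 1; ext p; simp only [kerT]; ring
  rw [formEL_eq, diffForm_eq_of_disjoint ha hb ha0 hb0 hab, h1]
  simp only [hab, integral_zero]; ring

lemma formB_eq_of_disjoint (hΩ : IsBoundedC11Domain Ω) {a b : V N → ℝ}
    (ha : a ∈ energySpace Ω) (hb : b ∈ energySpace Ω)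
    (ha0 : ∀ x, 0 ≤ a x) (hb0 : ∀ x, 0 ≤ b x) (hab : ∀ x, a x * b x = 0) :
    formB Ω a b = -(cN N * crossForm kerT a b) := by
  rw [formB, formEL_eq_of_disjoint hΩ ha hb ha0 hb0 hab]
  simp only [hab, integral_zero]; ring

/-- The full kernel is positive off the diagonal, and points are null because N ≥ 1. -/
lemma ae_eq_zero_or_of_crossForm_eq_zero (hN : 1 ≤ N) {a b : V N → ℝ}
    (ha0 : ∀ x, 0 ≤ a x) (hb0 : ∀ x, 0 ≤ b x)
    (hint : Integrable (fun p : V N × V N => a p.1 * b p.2 * kerT (p.1 - p.2))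
      (volume.prod volume)) (h : crossForm kerT a b = 0) :
    a =ᵐ[volume] 0 ∨ b =ᵐ[volume] 0 := by
  have : Nonempty (Fin N) := ⟨⟨0, hN⟩⟩
  have h0 : 0 ≤ fun p : V N × V N => a p.1 * b p.2 * kerT (p.1 - p.2) :=
    fun p => mul_nonneg (mul_nonneg (ha0 p.1) (hb0 p.2)) (kerT_nonneg _)
  have h1 := (integral_eq_zero_iff_of_nonneg h0 hint).1 h
  have h2 := Measure.ae_ae_of_ae_prod h1
  by_cases hb : b =ᵐ[volume] 0
  · exact Or.inr hb
  left
  filter_upwards [h2] with x hx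
  by_contra hax
  refine hb ?_
  filter_upwards [hx, Measure.ae_ne volume x] with y hy hyx
  have hpos : 0 < kerT (x - y) := kerK_add_kerJ_pos (sub_ne_zero.2 hyx.symm)
  simp only [Pi.zero_apply, mul_eq_zero, hpos.ne', or_false] at hy hax ⊢
  exact hy.resolve_left hax

/-! ### Truncated kernels -/

/-- The truncated kernel `min(k, n)`. -/
noncomputable def kerN (n : ℕ) (z : V N) : ℝ := min (kerK z) n

lemma kerN_nonneg (n : ℕ) (z : V N) : 0 ≤ kerN n z := le_min (kerK_nonneg z) n.cast_nonneg

lemma kerN_le (n : ℕ) (z : V N) : kerN n z ≤ n := min_le_right _ _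

lemma kerN_le_kerK (n : ℕ) (z : V N) : kerN n z ≤ kerK z := min_le_left _ _

lemma kerN_neg (n : ℕ) (z : V N) : kerN n (-z) = kerN n z := by simp [kerN, kerK_neg]

lemma measurable_kerN (n : ℕ) : Measurable (kerN n : V N → ℝ) :=
  measurable_kerK.min measurable_const

lemma abs_kerN_le (n : ℕ) (z : V N) : |kerN n z| ≤ n := by
  rw [abs_of_nonneg (kerN_nonneg n z)]; exact kerN_le n z

lemma integrable_kerN (n : ℕ) : Integrable (kerN n : V N → ℝ) := by
  have h0 : Integrable (indicator (Metric.ball (0 : V N) 1) (fun _ => (n : ℝ))) :=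
    (integrable_indicator_iff measurableSet_ball).2
      (integrableOn_const (by finiteness))
  refine h0.mono' (measurable_kerN n).aestronglyMeasurable (Eventually.of_forall fun z => ?_)
  rw [Real.norm_eq_abs]
  by_cases hz : z ∈ Metric.ball (0 : V N) 1
  · rw [indicator_of_mem hz]; exact abs_kerN_le n z
  · simp [indicator_of_notMem hz, kerN, kerK]

lemma tendsto_kerN (z : V N) : Tendsto (fun n => kerN n z) atTop (𝓝 (kerK z)) := by
  refine tendsto_const_nhds.congr' ?_
  filter_upwards [eventually_ge_atTop ⌈kerK z⌉₊] with n hn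
  exact (min_eq_left (Nat.ceil_le.1 hn)).symm

/-- In polar coordinates the integral becomes ∫₀¹ dr/r. This divergence is the source of all
coercivity below. -/
lemma not_integrable_kerK (hN : 1 ≤ N) : ¬ Integrable (kerK : V N → ℝ) := by
  have : Nonempty (Fin N) := ⟨⟨0, hN⟩⟩
  unfold kerK
  rw [integrable_indicator_iff measurableSet_ball,
    integrableOn_fun_norm_addHaar volume (f := fun r => 1 / r ^ N)]
  intro h
  have h2 : IntegrableOn (fun y : ℝ => y⁻¹) (Ioo 0 1) := by
    refine h.congr_fun (fun y hy => ?_) measurableSet_Ioo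
    have hy0 : y ≠ 0 := hy.1.ne'
    simp only [finrank_euclideanSpace, Fintype.card_fin, smul_eq_mul]
    obtain ⟨m, rfl⟩ : ∃ m, N = m + 1 := ⟨N - 1, by omega⟩
    simp only [Nat.add_sub_cancel, pow_succ]
    field_simp
  have h3 : IntervalIntegrable (fun y : ℝ => y⁻¹) volume 0 1 := by
    rw [intervalIntegrable_iff_integrableOn_Ioo_of_le zero_le_one]; exact h2
  simp [intervalIntegrable_inv_iff] at h3

/-- Fatou's lemma for a pointwise convergent sequence of nonnegative functions with bounded
integrals. -/
lemma integrable_and_integral_le_of_tendsto {α : Type*} [MeasurableSpace α] {μ : Measure α}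
    {F : ℕ → α → ℝ} {f : α → ℝ} {D : ℝ} (hF : ∀ n, Integrable (F n) μ) (hF0 : ∀ n x, 0 ≤ F n x)
    (hD : ∀ n, ∫ x, F n x ∂μ ≤ D) (hf0 : ∀ x, 0 ≤ f x) (hf : AEStronglyMeasurable f μ)
    (hlim : ∀ x, Tendsto (fun n => F n x) atTop (𝓝 (f x))) :
    Integrable f μ ∧ ∫ x, f x ∂μ ≤ D := by
  have h1 : ∫⁻ x, ENNReal.ofReal (f x) ∂μ ≤ ENNReal.ofReal D := by
    have h2 : ∫⁻ x, ENNReal.ofReal (f x) ∂μ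
        ≤ liminf (fun n => ∫⁻ x, ENNReal.ofReal (F n x) ∂μ) atTop := by
      refine le_trans (lintegral_mono fun x => ?_)
        (lintegral_liminf_le' fun n => (hF n).1.aemeasurable.ennreal_ofReal)
      exact ((ENNReal.continuous_ofReal.tendsto _).comp (hlim x)).liminf_eq.ge
    refine h2.trans (liminf_le_of_le (by isBoundedDefault) fun b hb => ?_)
    obtain ⟨n, hn⟩ := hb.exists
    refine hn.trans ?_
    rw [← ofReal_integral_eq_lintegral_ofReal (hF n) (Eventually.of_forall (hF0 n))]
    exact ENNReal.ofReal_le_ofReal (hD n)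
  have hD0 : 0 ≤ D := (integral_nonneg (hF0 0)).trans (hD 0)
  refine ⟨⟨hf, ?_⟩, ?_⟩
  · rw [hasFiniteIntegral_iff_ofReal (Eventually.of_forall hf0)]
    exact h1.trans_lt ENNReal.ofReal_lt_top
  · rw [integral_eq_lintegral_of_nonneg_ae (Eventually.of_forall hf0) hf]
    exact ENNReal.toReal_le_of_le_ofReal hD0 h1

/-- Bounded integrals of min(k,n) would make k integrable by Fatou. -/
lemma exists_le_integral_kerN (hN : 1 ≤ N) (M : ℝ) : ∃ n : ℕ, M ≤ ∫ z : V N, kerN n z := by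
  by_contra! hcon
  exact not_integrable_kerK hN (integrable_and_integral_le_of_tendsto integrable_kerN kerN_nonneg
    (fun n => (hcon n).le) kerK_nonneg measurable_kerK.aestronglyMeasurable tendsto_kerN).1

/-- The function is the integrand of the convolution of u² and min(k,n), both in L¹. -/
lemma integrable_sq_kerN {u : V N → ℝ} (hu : MemLp u 2 volume) (n : ℕ) :
    Integrable (fun p : V N × V N => u p.2 ^ 2 * kerN n (p.1 - p.2)) (volume.prod volume) :=
  Integrable.convolution_integrand (ContinuousLinearMap.mul ℝ ℝ) hu.integrable_sq
    (integrable_kerN n)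

lemma integral_sq_kerN {u : V N → ℝ} (hu : MemLp u 2 volume) (n : ℕ) :
    ∫ p : V N × V N, u p.2 ^ 2 * kerN n (p.1 - p.2) ∂(volume.prod volume)
      = (∫ z : V N, kerN n z) * ∫ x, u x ^ 2 := by
  rw [integral_prod_symm _ (integrable_sq_kerN hu n), ← integral_const_mul]
  congr 1; ext y
  simp only
  rw [integral_const_mul, integral_sub_right_eq_self (kerN n) y, mul_comm]

lemma integrable_diff_kerN {u : V N → ℝ} (hu : MemLp u 2 volume)
    (hu1 : Integrable u) (n : ℕ) :
    Integrable (fun p : V N × V N => (u p.1 - u p.2) * (u p.1 - u p.2) * kerN n (p.1 - p.2))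
      (volume.prod volume) ∧
    diffForm (kerN n) u u
      = 2 * (∫ z : V N, kerN n z) * (∫ x, u x ^ 2) - 2 * crossForm (kerN n) u u := by
  have h1 := integrable_sq_kerN hu n
  have h2 := h1.swap
  have h3 := integrable_cross_of_bounded (measurable_kerN n) (abs_kerN_le n) hu1 hu1
  have hpt : (fun p : V N × V N => (u p.1 - u p.2) * (u p.1 - u p.2) * kerN n (p.1 - p.2))
      = fun p => (u p.2 ^ 2 * kerN n (p.1 - p.2)
        + ((fun q : V N × V N => u q.2 ^ 2 * kerN n (q.1 - q.2)) ∘ Prod.swap) p)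
        - 2 * (u p.1 * u p.2 * kerN n (p.1 - p.2)) := by
    ext p
    simp only [Function.comp, Prod.fst_swap, Prod.snd_swap]
    rw [← kerN_neg n (p.2 - p.1), neg_sub]; ring
  refine ⟨hpt ▸ (h1.add h2).sub (h3.const_mul 2), ?_⟩
  unfold diffForm
  rw [hpt]
  refine (integral_sub (h1.add h2) (h3.const_mul 2)).trans ?_
  rw [integral_const_mul, integral_add' h1 h2]
  have h4 : ∫ p : V N × V N, ((fun q : V N × V N => u q.2 ^ 2 * kerN n (q.1 - q.2)) ∘ Prod.swap) p
      ∂(volume.prod volume) = (∫ z : V N, kerN n z) * ∫ x, u x ^ 2 :=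
    (integral_prod_swap _).trans (integral_sq_kerN hu n)
  rw [h4, integral_sq_kerN hu n, crossForm]
  ring

/-- The bounded kernel `min(k, n) + j`. -/
noncomputable def kerNJ (n : ℕ) (z : V N) : ℝ := kerN n z + kerJ z

lemma measurable_kerNJ (n : ℕ) : Measurable (kerNJ n : V N → ℝ) :=
  (measurable_kerN n).add measurable_kerJ

lemma abs_kerNJ_le (n : ℕ) (z : V N) : |kerNJ n z| ≤ n + 1 := by
  rw [kerNJ, abs_of_nonneg (add_nonneg (kerN_nonneg n z) (kerJ_nonneg z))]
  exact add_le_add (kerN_le n z) (kerJ_le_one z)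

lemma crossForm_kerNJ {u : V N → ℝ} (hu1 : Integrable u) (n : ℕ) :
    crossForm (kerNJ n) u u = crossForm (kerN n) u u + crossForm kerJ u u := by
  unfold crossForm
  rw [← integral_add (integrable_cross_of_bounded (measurable_kerN n) (abs_kerN_le n) hu1 hu1)
    (integrable_cross_of_bounded (C := 1) measurable_kerJ abs_kerJ_le_one hu1 hu1)]
  congr 1; ext p; simp only [kerNJ]; ring

/-- Lowering k to min(k,n) decreases the energy and allows the square to be expanded: the diagonal
terms give a large multiple of the mass, the rest joins j in a bounded kernel. -/
lemma formEL_ge_truncated (hN : 1 ≤ N) (hΩ : IsBoundedC11Domain Ω) {u : V N → ℝ}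
    (hu : u ∈ energySpace Ω) (n : ℕ) :
    (cN N * (∫ z : V N, kerN n z) + rhoN N) * (∫ x, u x ^ 2) - cN N * crossForm (kerNJ n) u u
      ≤ formEL u u := by
  have hu1 := integrable_of_mem hΩ hu.1 hu.2.1
  obtain ⟨hi, he⟩ := integrable_diff_kerN hu.1 hu1 n
  have hle : diffForm (kerN n) u u ≤ diffForm kerK u u := by
    refine integral_mono hi (integrable_diff hu hu) fun p => ?_
    exact mul_le_mul_of_nonneg_left (kerN_le_kerK n _) (mul_self_nonneg _)
  rw [he] at hle
  rw [formEL_eq, crossForm_kerNJ hu1]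
  simp_rw [← pow_two]
  nlinarith [mul_le_mul_of_nonneg_left hle (cN_pos hN).le]

lemma abs_crossForm_le {κ : V N → ℝ} {C : ℝ} (hC : ∀ z, |κ z| ≤ C) {u v : V N → ℝ}
    (hu : Integrable u) (hv : Integrable v) :
    |crossForm κ u v| ≤ C * ((∫ x, |u x|) * ∫ x, |v x|) := by
  have h1 : Integrable (fun p : V N × V N => C * (|u p.1| * |v p.2|)) (volume.prod volume) :=
    (hu.abs.mul_prod hv.abs).const_mul C
  have h2 : ∫ p : V N × V N, C * (|u p.1| * |v p.2|) ∂(volume.prod volume)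
      = C * ((∫ x, |u x|) * ∫ x, |v x|) := by
    rw [integral_const_mul, integral_prod_mul (fun x => |u x|) (fun x => |v x|)]
  rw [← h2, ← Real.norm_eq_abs]
  refine norm_integral_le_of_norm_le h1 (Eventually.of_forall fun p => ?_)
  rw [Real.norm_eq_abs, abs_mul, abs_mul, mul_comm C]
  exact mul_le_mul_of_nonneg_left (hC _) (by positivity)

/-- Cauchy–Schwarz on A, read off from the discriminant of t ↦ ∫ (t·1_A - |u|)². -/
lemma sq_integral_abs_le {u : V N → ℝ} (hu : MemLp u 2 volume) (hu1 : Integrable u)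
    {A : Set (V N)} (hA : MeasurableSet A) (hAfin : volume A ≠ ⊤) (h0 : ∀ᵐ x, x ∉ A → u x = 0) :
    (∫ x, |u x|) ^ 2 ≤ volume.real A * ∫ x, u x ^ 2 := by
  have h1 : ∀ t : ℝ, 0 ≤ volume.real A * (t * t) + (-2 * ∫ x, |u x|) * t + ∫ x, u x ^ 2 := by
    intro t
    have hA1 : Integrable (A.indicator fun _ => t ^ 2) :=
      (integrable_indicator_iff hA).2 (integrableOn_const hAfin)
    have h2 : 0 ≤ ∫ x, ((A.indicator (fun _ => t ^ 2) x + (-2 * t) * |u x|) + u x ^ 2) := by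
      refine integral_nonneg_of_ae ?_
      filter_upwards [h0] with x hx
      by_cases hxA : x ∈ A
      · simp only [Pi.zero_apply, indicator_of_mem hxA]
        nlinarith [sq_nonneg (t - |u x|), sq_abs (u x)]
      · simp [indicator_of_notMem hxA, hx hxA]
    have h3 := hu1.abs.const_mul (-2 * t)
    rw [integral_add (f := fun x => A.indicator (fun _ => t ^ 2) x + (-2 * t) * |u x|)
      (hA1.add h3) hu.integrable_sq, integral_add hA1 h3, integral_const_mul, integral_indicator hA] at h2
    simp only [integral_const, smul_eq_mul, measureReal_restrict_apply_univ] at h2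
    linarith
  have := discrim_le_zero h1
  rw [discrim] at this
  linarith

lemma formEL_coercive_aux (hN : 1 ≤ N) (hΩ : IsBoundedC11Domain Ω) {u : V N → ℝ}
    (hu : u ∈ energySpace Ω) (n : ℕ) {A : Set (V N)} (hA : MeasurableSet A)
    (hAfin : volume A ≠ ⊤) (h0 : ∀ᵐ x, x ∉ A → u x = 0) :
    (cN N * (∫ z : V N, kerN n z) + rhoN N - cN N * ((n + 1) * volume.real A)) * (∫ x, u x ^ 2)
      ≤ formEL u u := by
  have hu1 := integrable_of_mem hΩ hu.1 hu.2.1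
  have h1 := abs_crossForm_le (abs_kerNJ_le n) hu1 hu1
  have h2 := sq_integral_abs_le hu.1 hu1 hA hAfin h0
  have h3 := formEL_ge_truncated hN hΩ hu n
  have h4 : crossForm (kerNJ n) u u ≤ (n + 1) * (volume.real A * ∫ x, u x ^ 2) := by
    refine (le_abs_self _).trans (h1.trans ?_)
    rw [← pow_two]
    gcongr
  have h5 := mul_le_mul_of_nonneg_left h4 (cN_pos hN).le
  linarith

/-- The form is large on functions with small support. -/
lemma exists_small_support_coercive (hN : 1 ≤ N) (hΩ : IsBoundedC11Domain Ω) (M : ℝ) :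
    ∃ η : ℝ, 0 < η ∧ ∀ u ∈ energySpace Ω, ∀ A : Set (V N), MeasurableSet A → volume A ≠ ⊤ →
      volume.real A ≤ η → (∀ᵐ x, x ∉ A → u x = 0) → M * (∫ x, u x ^ 2) ≤ formEL u u := by
  have hc := cN_pos hN
  obtain ⟨n, hn⟩ := exists_le_integral_kerN (N := N) hN ((M + 1 - rhoN N) / cN N)
  -- The choice of n gives c_N∫min(k,n) + ρ_N ≥ M + 1; this η makes the bounded-kernel term cost at
  -- most 1.
  refine ⟨1 / (cN N * (n + 1)), by positivity, fun u hu A hA hAfin hAη h0 => ?_⟩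
  refine le_trans ?_ (formEL_coercive_aux hN hΩ hu n hA hAfin h0)
  refine mul_le_mul_of_nonneg_right ?_ (integral_nonneg fun x => sq_nonneg _)
  rw [div_le_iff₀ hc] at hn
  rw [le_div_iff₀ (by positivity)] at hAη
  nlinarith

/-! ### Lower boundedness and the variational inequality for λ₁ -/

lemma exists_formEL_lower_bound (hN : 1 ≤ N) (hΩ : IsBoundedC11Domain Ω) :
    ∃ C : ℝ, ∀ u ∈ energySpace Ω, C * (∫ x, u x ^ 2) ≤ formEL u u :=
  -- Truncation at n = 0 with support set Ω already suffices.
  ⟨_, fun _ hu => formEL_coercive_aux hN hΩ hu 0 hΩ.isOpen.measurableSet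
    hΩ.isBounded.measure_lt_top.ne hu.2.1⟩

lemma bddBelow_formEL (hN : 1 ≤ N) (hΩ : IsBoundedC11Domain Ω) :
    BddBelow ((fun u => formEL u u) '' sphereP Ω) := by
  obtain ⟨C, hC⟩ := exists_formEL_lower_bound hN hΩ
  refine ⟨C, ?_⟩
  rintro _ ⟨u, hu, rfl⟩
  have := hC u hu.1
  rwa [← massI_eq hu.1.2.1, hu.2, mul_one] at this

lemma smul_mem_sphereP {u : V N → ℝ} (hu : u ∈ energySpace Ω) (h : 0 < ∫ x, u x ^ 2) :
    (Real.sqrt (∫ x, u x ^ 2))⁻¹ • u ∈ sphereP Ω := by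
  refine ⟨smul_mem hu _, ?_⟩
  rw [massI_eq (smul_mem hu _).2.1]
  simp only [Pi.smul_apply, smul_eq_mul, mul_pow]
  rw [integral_const_mul, inv_pow, Real.sq_sqrt h.le, inv_mul_cancel₀ h.ne']

lemma lambda1_mul_le (hN : 1 ≤ N) (hΩ : IsBoundedC11Domain Ω) {u : V N → ℝ}
    (hu : u ∈ energySpace Ω) : lambda1 Ω * (∫ x, u x ^ 2) ≤ formEL u u := by
  have h0 : 0 ≤ ∫ x, u x ^ 2 := integral_nonneg fun x => sq_nonneg _
  rcases h0.eq_or_lt with h | h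
  · obtain ⟨C, hC⟩ := exists_formEL_lower_bound hN hΩ
    have := hC u hu
    rwa [← h, mul_zero] at this ⊢
  · have hmem := smul_mem_sphereP hu h
    have h1 := csInf_le (bddBelow_formEL hN hΩ) (mem_image_of_mem (fun u => formEL u u) hmem)
    change lambda1 Ω ≤ formEL _ _ at h1
    rw [formEL_smul_smul, inv_pow, Real.sq_sqrt h.le, inv_mul_eq_div, le_div_iff₀ h] at h1
    exact h1

lemma formB_self_nonneg (hN : 1 ≤ N) (hΩ : IsBoundedC11Domain Ω) {u : V N → ℝ}
    (hu : u ∈ energySpace Ω) : 0 ≤ formB Ω u u := by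
  have := lambda1_mul_le hN hΩ hu
  simp only [formB, ← pow_two]; linarith

/-- A nonnegative quadratic in t without constant term has no linear term: a zero of B lies in its
kernel, which is the Euler–Lagrange equation. -/
lemma formB_eq_zero_of_self (hN : 1 ≤ N) (hΩ : IsBoundedC11Domain Ω) {u v : V N → ℝ}
    (hu : u ∈ energySpace Ω) (hv : v ∈ energySpace Ω) (h : formB Ω u u = 0) :
    formB Ω u v = 0 := by
  have h1 : ∀ t : ℝ, 0 ≤ formB Ω v v * (t * t) + (2 * formB Ω u v) * t + 0 := by
    intro t
    have := formB_self_nonneg hN hΩ (add_smul_mem hu hv t)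
    rw [formB_add_smul_self hΩ hu hv, h] at this
    linarith
  have := discrim_le_zero h1
  rw [discrim] at this
  nlinarith

/-! ### A positive element of the energy space -/

lemma integrable_norm_sq_mul_kerK (hN : 1 ≤ N) : Integrable (fun z : V N => ‖z‖ ^ 2 * kerK z) := by
  have : Nonempty (Fin N) := ⟨⟨0, hN⟩⟩
  have h : (fun z : V N => ‖z‖ ^ 2 * kerK z)
      = indicator (Metric.ball 0 1) (fun z => ‖z‖ ^ 2 * (1 / ‖z‖ ^ N)) := by
    ext z
    by_cases hz : z ∈ Metric.ball (0 : V N) 1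
    · simp only [kerK, indicator_of_mem hz]
    · simp only [kerK, indicator_of_notMem hz, mul_zero]
  rw [h, integrable_indicator_iff measurableSet_ball,
    integrableOn_fun_norm_addHaar volume (f := fun r => r ^ 2 * (1 / r ^ N))]
  have h2 : IntegrableOn (fun y : ℝ => y) (Ioo 0 1) :=
    (continuous_id.integrableOn_Icc (a := (0 : ℝ)) (b := 1)).mono_set Ioo_subset_Icc_self
  refine h2.congr_fun (fun y hy => ?_) measurableSet_Ioo
  have hy0 : y ≠ 0 := hy.1.ne'
  simp only [finrank_euclideanSpace, Fintype.card_fin, smul_eq_mul]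
  obtain ⟨m, rfl⟩ : ∃ m, N = m + 1 := ⟨N - 1, by omega⟩
  simp only [Nat.add_sub_cancel, pow_succ]
  field_simp

/-- The distance to the complement of `Ω`. -/
noncomputable def distCompl (Ω : Set (V N)) (x : V N) : ℝ := Metric.infDist x Ωᶜ

lemma distCompl_nonneg (x : V N) : 0 ≤ distCompl Ω x := Metric.infDist_nonneg

lemma compl_nonempty (hN : 1 ≤ N) (hΩ : IsBoundedC11Domain Ω) : (Ωᶜ).Nonempty := by
  have : Nonempty (Fin N) := ⟨⟨0, hN⟩⟩
  rw [nonempty_compl]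
  rintro rfl
  exact NormedSpace.unbounded_univ ℝ (V N) hΩ.isBounded

lemma distCompl_pos (hN : 1 ≤ N) (hΩ : IsBoundedC11Domain Ω) {x : V N} (hx : x ∈ Ω) :
    0 < distCompl Ω x :=
  (hΩ.isOpen.isClosed_compl.notMem_iff_infDist_pos (compl_nonempty hN hΩ)).1 (by simpa using hx)

lemma distCompl_eq_zero {x : V N} (hx : x ∉ Ω) : distCompl Ω x = 0 :=
  Metric.infDist_zero_of_mem hx

lemma continuous_distCompl : Continuous (distCompl Ω) := Metric.continuous_infDist_pt _

lemma abs_distCompl_sub_le (x y : V N) : |distCompl Ω x - distCompl Ω y| ≤ ‖x - y‖ := by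
  have := (Metric.lipschitz_infDist_pt Ωᶜ).dist_le_mul x y
  simpa [distCompl, Real.dist_eq, dist_eq_norm] using this

lemma memLp_distCompl (hN : 1 ≤ N) (hΩ : IsBoundedC11Domain Ω) :
    MemLp (distCompl Ω) 2 volume := by
  obtain ⟨z, hz⟩ := compl_nonempty hN hΩ
  obtain ⟨R, hR⟩ := hΩ.isBounded.subset_closedBall z
  have h1 : MemLp (Ω.indicator fun _ => R) 2 volume :=
    memLp_indicator_const 2 hΩ.isOpen.measurableSet R (Or.inr hΩ.isBounded.measure_lt_top.ne)
  refine h1.of_le continuous_distCompl.aestronglyMeasurable (Eventually.of_forall fun x => ?_)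
  by_cases hx : x ∈ Ω
  · rw [indicator_of_mem hx, Real.norm_eq_abs, Real.norm_eq_abs,
      abs_of_nonneg (distCompl_nonneg x)]
    exact ((Metric.infDist_le_dist_of_mem hz).trans (hR hx)).trans (le_abs_self R)
  · simp [indicator_of_notMem hx, distCompl_eq_zero hx]

/-- Increments are bounded by |x-y| and vanish unless x or y lies in Ω, and |z|²k(z) is integrable.
This function shows that 𝒫 is nonempty and later serves as comparison function for positivity. -/
lemma distCompl_mem (hN : 1 ≤ N) (hΩ : IsBoundedC11Domain Ω) : distCompl Ω ∈ energySpace Ω := by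
  refine ⟨memLp_distCompl hN hΩ, Eventually.of_forall fun x => distCompl_eq_zero, ?_⟩
  have h1 : Integrable (Ω.indicator fun _ => (1 : ℝ)) :=
    (integrable_indicator_iff hΩ.isOpen.measurableSet).2
      (integrableOn_const hΩ.isBounded.measure_lt_top.ne)
  have h2 : Integrable (fun p : V N × V N => Ω.indicator (fun _ => (1 : ℝ)) p.2
      * (‖p.1 - p.2‖ ^ 2 * kerK (p.1 - p.2))) (volume.prod volume) :=
    Integrable.convolution_integrand (ContinuousLinearMap.mul ℝ ℝ) h1
      (integrable_norm_sq_mul_kerK hN)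
  refine (h2.add h2.swap).mono' ?_ (Eventually.of_forall fun p => ?_)
  · have h := continuous_distCompl (Ω := Ω).aestronglyMeasurable (μ := volume)
    exact ((h.comp_fst.sub h.comp_snd).pow 2).mul (aestronglyMeasurable_kernel measurable_kerK)
  · have hk := kerK_nonneg (p.1 - p.2)
    have hk' : kerK (p.2 - p.1) = kerK (p.1 - p.2) := by rw [← kerK_neg, neg_sub]
    have hn : ‖p.2 - p.1‖ = ‖p.1 - p.2‖ := norm_sub_rev _ _
    have hsq : (distCompl Ω p.1 - distCompl Ω p.2) ^ 2 ≤ ‖p.1 - p.2‖ ^ 2 := by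
      rw [← sq_abs]; gcongr; exact abs_distCompl_sub_le _ _
    have hm := mul_le_mul_of_nonneg_right hsq hk
    have hq : 0 ≤ ‖p.1 - p.2‖ ^ 2 * kerK (p.1 - p.2) := by positivity
    simp only [Pi.add_apply, Function.comp, Prod.fst_swap, Prod.snd_swap, hk', hn]
    rw [Real.norm_eq_abs, abs_of_nonneg (mul_nonneg (sq_nonneg _) hk)]
    by_cases hx : p.1 ∈ Ω <;> by_cases hy : p.2 ∈ Ω <;>
      simp only [hx, hy, not_false_eq_true, indicator_of_mem, indicator_of_notMem, one_mul,
        zero_mul, add_zero, zero_add]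
    · linarith
    · exact hm
    · exact hm
    · rw [distCompl_eq_zero hx, distCompl_eq_zero hy]; simp

lemma integral_sq_pos {u : V N → ℝ} (hu : MemLp u 2 volume) (h : ¬ u =ᵐ[volume] 0) :
    0 < ∫ x, u x ^ 2 := by
  refine lt_of_le_of_ne (integral_nonneg fun x => sq_nonneg _) fun h0 => h ?_
  have := (integral_eq_zero_iff_of_nonneg (fun x => sq_nonneg (u x)) hu.integrable_sq).1 h0.symm
  filter_upwards [this] with x hx
  simpa using hx

lemma sphereP_nonempty (hN : 1 ≤ N) (hΩ : IsBoundedC11Domain Ω) : (sphereP Ω).Nonempty := by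
  have hmem := distCompl_mem hN hΩ
  refine ⟨_, smul_mem_sphereP hmem (integral_sq_pos hmem.1 fun h => ?_)⟩
  have h1 : volume Ω = 0 := measure_mono_null (fun x hx => (distCompl_pos hN hΩ hx).ne') h
  exact (hΩ.isOpen.measure_pos volume hΩ.isConnected.nonempty).ne' h1

/-! ### Weak compactness -/

/-- Sequential Banach–Alaoglu, transported through the Riesz isomorphism. -/
lemma exists_weakly_convergent_subseq {H : Type*} [NormedAddCommGroup H] [InnerProductSpace ℝ H]
    [CompleteSpace H] [TopologicalSpace.SeparableSpace H] (u : ℕ → H) {C : ℝ}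
    (hC : ∀ n, ‖u n‖ ≤ C) :
    ∃ a : H, ∃ φ : ℕ → ℕ, StrictMono φ ∧
      ∀ v : H, Tendsto (fun n => inner ℝ (u (φ n)) v) atTop (𝓝 (inner ℝ a v)) := by
  have hc := WeakDual.isSeqCompact_closedBall ℝ H (0 : StrongDual ℝ H) C
  obtain ⟨x, -, φ, hφ, hx⟩ := hc (x := fun n =>
    StrongDual.toWeakDual (InnerProductSpace.toDual ℝ H (u n))) (fun n => by simpa using hC n)
  refine ⟨(InnerProductSpace.toDual ℝ H).symm (WeakDual.toStrongDual x), φ, hφ, fun v => ?_⟩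
  rw [InnerProductSpace.toDual_symm_apply]
  exact ((WeakDual.eval_continuous v).tendsto x).comp hx

lemma exists_weak_limit (hΩ : IsBoundedC11Domain Ω) {u : ℕ → V N → ℝ}
    (hu : ∀ n, MemLp (u n) 2 volume) (hu0 : ∀ n, ∀ᵐ x, x ∉ Ω → u n x = 0)
    (hu1 : ∀ n, ∫ x, u n x ^ 2 = 1) :
    ∃ a : V N → ℝ, ∃ φ : ℕ → ℕ, StrictMono φ ∧ MemLp a 2 volume ∧ (∀ x, x ∉ Ω → a x = 0) ∧
      ∫ x, a x ^ 2 ≤ 1 ∧ ∀ v : V N → ℝ, MemLp v 2 volume →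
        Tendsto (fun n => ∫ x, u (φ n) x * v x) atTop (𝓝 (∫ x, a x * v x)) := by
  have hinner : ∀ (f g : V N → ℝ) (hf : MemLp f 2 volume) (hg : MemLp g 2 volume),
      inner ℝ (hf.toLp f) (hg.toLp g) = ∫ x, f x * g x := by
    intro f g hf hg
    rw [L2.inner_def]
    refine integral_congr_ae ?_
    filter_upwards [hf.coeFn_toLp, hg.coeFn_toLp] with x h1 h2
    rw [h1, h2]; simp [mul_comm]
  have : Fact ((2 : ENNReal) ≠ ⊤) := ⟨by norm_num⟩
  obtain ⟨b, φ, hφ, hb⟩ := exists_weakly_convergent_subseq (fun n => (hu n).toLp (u n)) (C := 1)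
    (fun n => by
      have h : ‖(hu n).toLp (u n)‖ ^ 2 = 1 := by
        rw [← real_inner_self_eq_norm_sq, hinner, ← hu1 n]
        simp_rw [pow_two]
      nlinarith [norm_nonneg ((hu n).toLp (u n))])
  have hΩm := hΩ.isOpen.measurableSet
  have hbL : MemLp b 2 volume := Lp.memLp b
  have ha : MemLp (Ω.indicator b) 2 volume := hbL.indicator hΩm
  have hw : ∀ v : V N → ℝ, MemLp v 2 volume →
      Tendsto (fun n => ∫ x, u (φ n) x * v x) atTop (𝓝 (∫ x, Ω.indicator b x * v x)) := by
    intro v hv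
    have hv' : MemLp (Ω.indicator v) 2 volume := hv.indicator hΩm
    have h1 := hb (hv'.toLp _)
    have h2 : inner ℝ b (hv'.toLp _) = ∫ x, Ω.indicator b x * v x := by
      have := hinner b _ hbL hv'
      rw [Lp.toLp_coeFn] at this
      rw [this]
      congr 1; ext x
      by_cases hx : x ∈ Ω <;> simp [hx]
    rw [h2] at h1
    refine h1.congr fun n => ?_
    rw [hinner]
    refine integral_congr_ae ?_
    filter_upwards [hu0 (φ n)] with x hx
    by_cases hxΩ : x ∈ Ω
    · simp [hxΩ]
    · simp [hx hxΩ]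
  -- The bound on the mass of the limit a follows by testing with a itself: 2u_n a ≤ u_n² + a² gives
  -- ∫a² ≤ (1 + ∫a²)/2.
  refine ⟨Ω.indicator b, φ, hφ, ha, fun x hx => by simp [hx], ?_, hw⟩
  have h3 := le_of_tendsto (hw _ ha) (b := (1 + ∫ x, Ω.indicator b x ^ 2) / 2)
    (Eventually.of_forall fun n => ?_)
  · simp_rw [← pow_two] at h3
    linarith
  · rw [← hu1 (φ n), ← integral_add (hu (φ n)).integrable_sq ha.integrable_sq, ← integral_div]
    refine integral_mono (integrable_mul_of_memLp (hu _) ha)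
      (((hu (φ n)).integrable_sq.add ha.integrable_sq).div_const 2) fun x => ?_
    simp only
    nlinarith [sq_nonneg (u (φ n) x - Ω.indicator b x)]

lemma sq_integral_mul_le {u v : V N → ℝ} (hu : MemLp u 2 volume) (hv : MemLp v 2 volume) :
    (∫ x, u x * v x) ^ 2 ≤ (∫ x, u x ^ 2) * ∫ x, v x ^ 2 := by
  have h1 : ∀ t : ℝ, 0 ≤ (∫ x, v x ^ 2) * (t * t) + (2 * ∫ x, u x * v x) * t
      + ∫ x, u x ^ 2 := by
    intro t
    have hw : MemLp (u + t • v) 2 volume := hu.add (hv.const_smul t)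
    have h2 : 0 ≤ ∫ x, (u + t • v) x * (u + t • v) x := integral_nonneg fun x => mul_self_nonneg _
    rw [integral_mul_add_smul t hu hv hw] at h2
    simp_rw [mul_comm _ ((u + t • v) _)] at h2
    rw [integral_mul_add_smul t hu hv hu, integral_mul_add_smul t hu hv hv] at h2
    simp_rw [← pow_two, mul_comm (v _)] at h2
    linarith
  have := discrim_le_zero h1
  rw [discrim] at this
  linarith

/-! ### Weak continuity of forms with bounded kernel -/

/-- The potential `x ↦ 1_Ω(x) ∫ κ(x - y) u(y) dy`. -/
noncomputable def potential (Ω : Set (V N)) (κ : V N → ℝ) (u : V N → ℝ) : V N → ℝ :=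
  Ω.indicator fun x => ∫ y, u y * κ (x - y)

lemma abs_potential_le {κ : V N → ℝ} {C : ℝ} (hC : ∀ z, |κ z| ≤ C) {u : V N → ℝ}
    (hu1 : Integrable u) (x : V N) :
    |potential Ω κ u x| ≤ Ω.indicator (fun _ => C * ∫ y, |u y|) x := by
  by_cases hx : x ∈ Ω
  · simp only [potential, indicator_of_mem hx]
    rw [← integral_const_mul, ← Real.norm_eq_abs]
    refine norm_integral_le_of_norm_le (hu1.abs.const_mul C) (Eventually.of_forall fun y => ?_)
    rw [Real.norm_eq_abs, abs_mul, mul_comm]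
    exact mul_le_mul_of_nonneg_right (hC _) (abs_nonneg _)
  · simp [potential, hx]

lemma memLp_potential (hΩ : IsBoundedC11Domain Ω) {κ : V N → ℝ} (hκ : Measurable κ) {C : ℝ}
    (hC : ∀ z, |κ z| ≤ C) {u : V N → ℝ} (hu1 : Integrable u) :
    MemLp (potential Ω κ u) 2 volume := by
  have h1 : MemLp (Ω.indicator fun _ => C * ∫ y, |u y|) 2 (volume : Measure (V N)) :=
    memLp_indicator_const 2 hΩ.isOpen.measurableSet _ (Or.inr hΩ.isBounded.measure_lt_top.ne)
  refine h1.of_le ?_ (Eventually.of_forall fun x => ?_)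
  · refine AEStronglyMeasurable.indicator ?_ hΩ.isOpen.measurableSet
    exact (hu1.1.comp_snd.mul (aestronglyMeasurable_kernel hκ)).integral_prod_right'
  · exact (abs_potential_le hC hu1 x).trans (le_abs_self _)

lemma crossForm_eq_integral_potential {κ : V N → ℝ} (hκ : Measurable κ) {C : ℝ}
    (hC : ∀ z, |κ z| ≤ C) {u : V N → ℝ} (hu1 : Integrable u)
    (hu0 : ∀ᵐ x, x ∉ Ω → u x = 0) : crossForm κ u u = ∫ x, u x * potential Ω κ u x := by
  rw [crossForm, integral_prod _ (integrable_cross_of_bounded hκ hC hu1 hu1)]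
  refine integral_congr_ae ?_
  filter_upwards [hu0] with x hx
  by_cases hxΩ : x ∈ Ω
  · simp only [potential, indicator_of_mem hxΩ, mul_assoc, integral_const_mul]
  · simp [hx hxΩ]

lemma integral_abs_le_of_integral_sq_le (hΩ : IsBoundedC11Domain Ω) {u : V N → ℝ}
    (hu : MemLp u 2 volume) (hu0 : ∀ᵐ x, x ∉ Ω → u x = 0) (hu1 : ∫ x, u x ^ 2 ≤ 1) :
    ∫ x, |u x| ≤ volume.real Ω + 1 := by
  have h := sq_integral_abs_le hu (integrable_of_mem hΩ hu hu0) hΩ.isOpen.measurableSet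
    hΩ.isBounded.measure_lt_top.ne hu0
  have h0 : 0 ≤ volume.real Ω := measureReal_nonneg
  nlinarith [mul_le_mul_of_nonneg_left hu1 h0]

/-- A bounded kernel on a bounded domain acts compactly: the potentials converge pointwise by weak
convergence, hence in L² by domination. The form is then a pairing of a weakly and a strongly
convergent sequence. -/
lemma tendsto_crossForm (hΩ : IsBoundedC11Domain Ω) {κ : V N → ℝ} (hκ : Measurable κ) {C : ℝ}
    (hC : ∀ z, |κ z| ≤ C) {u : ℕ → V N → ℝ} {a : V N → ℝ}
    (hu : ∀ n, MemLp (u n) 2 volume) (hu0 : ∀ n, ∀ᵐ x, x ∉ Ω → u n x = 0)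
    (hu1 : ∀ n, ∫ x, u n x ^ 2 = 1) (ha : MemLp a 2 volume) (ha0 : ∀ x, x ∉ Ω → a x = 0)
    (ha1 : ∫ x, a x ^ 2 ≤ 1)
    (hw : ∀ v : V N → ℝ, MemLp v 2 volume →
      Tendsto (fun n => ∫ x, u n x * v x) atTop (𝓝 (∫ x, a x * v x))) :
    Tendsto (fun n => crossForm κ (u n) (u n)) atTop (𝓝 (crossForm κ a a)) := by
  have hΩm := hΩ.isOpen.measurableSet
  have hΩf := (hΩ.isBounded.measure_lt_top (μ := volume)).ne
  have hC0 : 0 ≤ C := (abs_nonneg _).trans (hC 0)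
  have hui := fun n => integrable_of_mem hΩ (hu n) (hu0 n)
  have ha0' : ∀ᵐ x, x ∉ Ω → a x = 0 := Eventually.of_forall ha0
  have hai := integrable_of_mem hΩ ha ha0'
  have hG := fun n => memLp_potential hΩ hκ hC (hui n)
  have hGa := memLp_potential hΩ hκ hC hai
  set K := volume.real Ω + 1
  have hlim : ∀ x, Tendsto (fun n => potential Ω κ (u n) x) atTop (𝓝 (potential Ω κ a x)) := by
    intro x
    by_cases hx : x ∈ Ω
    · have hv : MemLp (Ω.indicator fun y => κ (x - y)) 2 volume := by
        have h1 : MemLp (Ω.indicator fun _ => C) 2 (volume : Measure (V N)) :=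
          memLp_indicator_const 2 hΩm _ (Or.inr hΩf)
        refine h1.of_le ((hκ.comp (measurable_const.sub measurable_id)).aestronglyMeasurable.indicator
          hΩm) (Eventually.of_forall fun y => ?_)
        by_cases hy : y ∈ Ω
        · simp only [indicator_of_mem hy]; exact (hC _).trans (le_abs_self _)
        · simp [hy]
      have key : ∀ f : V N → ℝ, (∀ᵐ x, x ∉ Ω → f x = 0) →
          ∫ y, f y * Ω.indicator (fun y => κ (x - y)) y = potential Ω κ f x := by
        intro f hf
        simp only [potential, indicator_of_mem hx]
        refine integral_congr_ae ?_
        filter_upwards [hf] with y hy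
        by_cases hyΩ : y ∈ Ω
        · simp [hyΩ]
        · simp [hy hyΩ]
      have h2 := hw _ hv
      rw [key a ha0'] at h2
      exact h2.congr fun n => key _ (hu0 n)
    · simp [potential, hx]
  have hdiff : Tendsto (fun n => ∫ x, (potential Ω κ (u n) x - potential Ω κ a x) ^ 2) atTop
      (𝓝 0) := by
    have h0 : (0 : ℝ) = ∫ _ : V N, (0 : ℝ) := by simp
    rw [h0]
    refine tendsto_integral_of_dominated_convergence (Ω.indicator fun _ => (2 * (C * K)) ^ 2)
      (fun n => (((hG n).sub hGa).1.pow 2)) ?_ (fun n => Eventually.of_forall fun x => ?_)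
      (Eventually.of_forall fun x => ?_)
    · exact (integrable_indicator_iff hΩm).2 (integrableOn_const hΩf)
    · by_cases hx : x ∈ Ω
      · have h1 := abs_potential_le (Ω := Ω) hC (hui n) x
        have h2 := abs_potential_le (Ω := Ω) hC hai x
        rw [indicator_of_mem hx] at h1 h2 ⊢
        have h3 := mul_le_mul_of_nonneg_left
          (integral_abs_le_of_integral_sq_le hΩ (hu n) (hu0 n) (hu1 n).le) hC0
        have h4 := mul_le_mul_of_nonneg_left
          (integral_abs_le_of_integral_sq_le hΩ ha ha0' ha1) hC0
        rw [norm_pow, Real.norm_eq_abs]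
        gcongr
        refine (abs_sub _ _).trans ?_
        linarith
      · simp [potential, hx]
    · have := ((hlim x).sub_const (potential Ω κ a x)).pow 2
      simpa using this
  have hfirst : Tendsto (fun n => ∫ x, u n x * (potential Ω κ (u n) - potential Ω κ a) x) atTop
      (𝓝 0) := by
    have h1 : Tendsto (fun n => Real.sqrt (∫ x, (potential Ω κ (u n) x - potential Ω κ a x) ^ 2))
        atTop (𝓝 0) := by
      have := (Real.continuous_sqrt.tendsto 0).comp hdiff
      rwa [Real.sqrt_zero] at this
    refine squeeze_zero_norm (fun n => ?_) h1
    rw [Real.norm_eq_abs]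
    refine Real.abs_le_sqrt ?_
    have := sq_integral_mul_le (hu n) ((hG n).sub hGa)
    rwa [hu1 n, one_mul] at this
  have hsum := hfirst.add (hw _ hGa)
  rw [zero_add, ← crossForm_eq_integral_potential hκ hC hai ha0'] at hsum
  refine hsum.congr fun n => ?_
  rw [crossForm_eq_integral_potential hκ hC (hui n) (hu0 n),
    ← integral_add (integrable_mul_of_memLp (hu n) ((hG n).sub hGa))
      (integrable_mul_of_memLp (hu n) hGa)]
  congr 1; ext x
  simp only [Pi.sub_apply]; ring

/-! ### Existence of a minimizer -/

lemma exists_minimizer (hN : 1 ≤ N) (hΩ : IsBoundedC11Domain Ω) :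
    ∃ u ∈ sphereP Ω, formEL u u = lambda1 Ω := by
  have hc := cN_pos hN
  obtain ⟨y, -, hy, hymem⟩ := exists_seq_tendsto_sInf
    ((sphereP_nonempty hN hΩ).image fun u => formEL u u) (bddBelow_formEL hN hΩ)
  choose w hwP hwy using hymem
  have hw1 : ∀ n, ∫ x, w n x ^ 2 = 1 := fun n => by
    rw [← massI_eq (hwP n).1.2.1]; exact (hwP n).2
  obtain ⟨a, φ, hφ, ha, ha0, ha1, hw⟩ := exists_weak_limit hΩ (fun n => (hwP n).1.1)
    (fun n => (hwP n).1.2.1) hw1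
  have ha0' : ∀ᵐ x, x ∉ Ω → a x = 0 := Eventually.of_forall ha0
  have hai := integrable_of_mem hΩ ha ha0'
  have hylim : Tendsto (fun n => formEL (w (φ n)) (w (φ n))) atTop (𝓝 (lambda1 Ω)) :=
    (hy.comp hφ.tendsto_atTop).congr fun n => (hwy (φ n)).symm
  set I := ∫ x, a x ^ 2 with hI
  -- The truncated lower bound passes to the weak limit; the lost mass 1 - I appears multiplied by
  -- the integral of min(k,n).
  have hkey : ∀ n, cN N * (∫ z : V N, kerN n z) * (1 - I) + cN N / 2 * diffForm (kerN n) a a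
      - cN N * crossForm kerJ a a + rhoN N ≤ lambda1 Ω := by
    intro n
    have h1 := tendsto_crossForm hΩ (measurable_kerNJ n) (abs_kerNJ_le n)
      (fun m => (hwP (φ m)).1.1) (fun m => (hwP (φ m)).1.2.1) (fun m => hw1 (φ m)) ha ha0 ha1 hw
    have h2 := (h1.const_mul (cN N)).const_sub (cN N * (∫ z : V N, kerN n z) + rhoN N)
    have h3 := le_of_tendsto_of_tendsto' h2 hylim fun m => by
      have := formEL_ge_truncated hN hΩ (hwP (φ m)).1 n
      rwa [hw1, mul_one] at this
    rw [crossForm_kerNJ hai] at h3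
    rw [(integrable_diff_kerN ha hai n).2]
    linarith
  have hdiff0 : ∀ n, 0 ≤ diffForm (kerN n) a a := fun n =>
    integral_nonneg fun p => mul_nonneg (mul_self_nonneg _) (kerN_nonneg _ _)
  -- Were mass lost, that integral could be taken large enough to contradict `hkey`.
  have hI1 : I = 1 := by
    by_contra hne
    have hlt : 0 < 1 - I := sub_pos.2 (lt_of_le_of_ne ha1 hne)
    obtain ⟨n, hn⟩ := exists_le_integral_kerN (N := N) hN
      ((lambda1 Ω + cN N * crossForm kerJ a a - rhoN N + 1) / (cN N * (1 - I)))
    rw [div_le_iff₀ (by positivity)] at hn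
    have := hkey n
    have := mul_nonneg hc.le (hdiff0 n)
    linarith
  have hD : ∀ n, diffForm (kerN n) a a
      ≤ 2 / cN N * (lambda1 Ω + cN N * crossForm kerJ a a - rhoN N) := by
    intro n
    have := hkey n
    rw [hI1] at this
    rw [div_mul_eq_mul_div, le_div_iff₀ hc]
    linarith
  -- Fatou in n gives both finite energy of a and the minimizing inequality.
  obtain ⟨h1, h2⟩ := integrable_and_integral_le_of_tendsto
    (fun n => (integrable_diff_kerN ha hai n).1)
    (fun n p => mul_nonneg (mul_self_nonneg _) (kerN_nonneg _ _)) hD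
    (fun p => mul_nonneg (mul_self_nonneg _) (kerK_nonneg (p.1 - p.2)))
    (aestronglyMeasurable_diff measurable_kerK ha.1 ha.1)
    (fun p => (tendsto_kerN (p.1 - p.2)).const_mul _)
  have hmem : a ∈ energySpace Ω := ⟨ha, ha0', by simpa only [pow_two] using h1⟩
  have hP : a ∈ sphereP Ω := ⟨hmem, by rw [massI_eq ha0', ← hI, hI1]⟩
  refine ⟨a, hP, le_antisymm ?_ (csInf_le (bddBelow_formEL hN hΩ) (mem_image_of_mem _ hP))⟩
  change diffForm kerK a a ≤ _ at h2
  rw [formEL_eq]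
  simp_rw [← pow_two]
  rw [← hI, hI1]
  rw [div_mul_eq_mul_div, le_div_iff₀ hc] at h2
  linarith

/-! ### Positive and negative parts of minimizers -/

lemma formB_posPart (hΩ : IsBoundedC11Domain Ω) {u : V N → ℝ} (hu : u ∈ energySpace Ω) :
    formB Ω (posPart u) (posPart (-u)) = -(cN N * crossForm kerT (posPart u) (posPart (-u))) :=
  formB_eq_of_disjoint hΩ (posPart_mem hu) (posPart_mem (neg_mem hu)) (posPart_nonneg _)
    (posPart_nonneg _) (posPart_mul_posPart_neg u)

lemma formB_self_eq_posPart (hΩ : IsBoundedC11Domain Ω) {u : V N → ℝ} (hu : u ∈ energySpace Ω) :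
    formB Ω u u = formB Ω (posPart u) (posPart u) + formB Ω (posPart (-u)) (posPart (-u))
      + 2 * (cN N * crossForm kerT (posPart u) (posPart (-u))) := by
  have h := formB_add_smul_self hΩ (posPart_mem hu) (posPart_mem (neg_mem hu)) (-1)
  rw [posPart_sub_posPart_neg, formB_posPart hΩ hu] at h
  rw [h]; ring

/-- A function at which the nonnegative form `B` vanishes has constant sign. -/
lemma posPart_eq_zero_or (hN : 1 ≤ N) (hΩ : IsBoundedC11Domain Ω) {u : V N → ℝ}
    (hu : u ∈ energySpace Ω) (h : formB Ω u u = 0) :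
    posPart u =ᵐ[volume] 0 ∨ posPart (-u) =ᵐ[volume] 0 := by
  have h1 := formB_self_eq_posPart hΩ hu
  have h2 := formB_self_nonneg hN hΩ (posPart_mem hu)
  have h3 := formB_self_nonneg hN hΩ (posPart_mem (neg_mem hu))
  have h4 : 0 ≤ crossForm kerT (posPart u) (posPart (-u)) :=
    crossForm_nonneg kerT_nonneg (posPart_nonneg _) (posPart_nonneg _)
  have hc := cN_pos hN
  refine ae_eq_zero_or_of_crossForm_eq_zero hN (posPart_nonneg _) (posPart_nonneg _)
    (integrable_cross_kerT hΩ (posPart_mem hu) (posPart_mem (neg_mem hu)) (posPart_nonneg _)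
      (posPart_nonneg _) (posPart_mul_posPart_neg u)) ?_
  nlinarith [mul_nonneg hc.le h4]

lemma isFirstEigenfunction_of_formB_eq_zero (hN : 1 ≤ N) (hΩ : IsBoundedC11Domain Ω)
    {u : V N → ℝ} (hu : u ∈ sphereP Ω) (h0 : ∀ᵐ x, 0 ≤ u x) (h : formB Ω u u = 0) :
    IsFirstEigenfunction Ω u := by
  refine ⟨hu, fun v hv => ?_, h0⟩
  have := formB_eq_zero_of_self hN hΩ hu.1 hv h
  rw [setIntegral_mul_eq hv.2.1]
  rw [formB] at this
  linarith

lemma formB_self_eq {u : V N → ℝ} (hu : u ∈ sphereP Ω) :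
    formB Ω u u = formEL u u - lambda1 Ω := by
  have := hu.2
  rw [massI_eq hu.1.2.1] at this
  simp only [formB, ← pow_two, this, mul_one]

lemma exists_isFirstEigenfunction (hN : 1 ≤ N) (hΩ : IsBoundedC11Domain Ω) :
    ∃ φ, IsFirstEigenfunction Ω φ := by
  obtain ⟨u, hu, he⟩ := exists_minimizer hN hΩ
  have hB : formB Ω u u = 0 := by rw [formB_self_eq hu, he, sub_self]
  -- The minimizer has constant sign; if it is nonpositive, its negative is used.
  rcases posPart_eq_zero_or hN hΩ hu.1 hB with h | h
  · refine ⟨-u, isFirstEigenfunction_of_formB_eq_zero hN hΩ ⟨neg_mem hu.1, ?_⟩ ?_ ?_⟩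
    · rw [← hu.2]; simp [massI]
    · filter_upwards [h] with x hx
      simpa [posPart] using hx
    · have := formB_add_smul_self hΩ zero_mem_energySpace hu.1 (-1)
      rw [formB_symm 0 u, formB_eq_zero_of_self hN hΩ hu.1 zero_mem_energySpace hB, hB] at this
      have h0 : formB Ω (0 : V N → ℝ) 0 = 0 := by
        simp [formB, formEL_eq, diffForm, crossForm]
      rw [h0] at this
      simpa using this
  · refine ⟨u, isFirstEigenfunction_of_formB_eq_zero hN hΩ hu ?_ hB⟩
    filter_upwards [h] with x hx
    simpa [posPart] using hx

/-! ### Poincaré inequality -/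

lemma memLp_translate {u : V N → ℝ} (hu : MemLp u 2 volume) (h : V N) :
    MemLp (fun x => u (h + x)) 2 volume :=
  hu.comp_measurePreserving (measurePreserving_add_left volume h)

/-- The increment over m·h telescopes into m increments over h, all with the same L² norm by
translation invariance; Cauchy–Schwarz for the sum gives m². -/
lemma integral_sq_translate_nsmul_le {u : V N → ℝ} (hu : MemLp u 2 volume) (h : V N) (m : ℕ) :
    ∫ x, (u (m • h + x) - u x) ^ 2 ≤ m ^ 2 * ∫ x, (u (h + x) - u x) ^ 2 := by
  have hint : ∀ i : ℕ, Integrable fun x => (u ((i + 1) • h + x) - u (i • h + x)) ^ 2 := fun i =>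
    ((memLp_translate hu _).sub (memLp_translate hu _)).integrable_sq
  have htr : ∀ i : ℕ, ∫ x, (u ((i + 1) • h + x) - u (i • h + x)) ^ 2
      = ∫ x, (u (h + x) - u x) ^ 2 := by
    intro i
    rw [← integral_add_left_eq_self (fun x => (u (h + x) - u x) ^ 2) (i • h)]
    congr 1; ext x
    rw [succ_nsmul', add_assoc]
  calc ∫ x, (u (m • h + x) - u x) ^ 2
      ≤ ∫ x, (m : ℝ) * ∑ i ∈ Finset.range m, (u ((i + 1) • h + x) - u (i • h + x)) ^ 2 := by
        refine integral_mono ((memLp_translate hu _).sub hu).integrable_sq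
          ((integrable_finsetSum _ fun i _ => hint i).const_mul _) fun x => ?_
        have h1 := sq_sum_le_card_mul_sum_sq (s := Finset.range m)
          (f := fun i => u ((i + 1) • h + x) - u (i • h + x))
        rw [Finset.sum_range_sub (fun i => u (i • h + x)), Finset.card_range] at h1
        simpa using h1
    _ = _ := by
        rw [integral_const_mul, integral_finsetSum _ fun i _ => hint i]
        simp_rw [htr]
        simp only [Finset.sum_const, Finset.card_range, nsmul_eq_mul]
        ring

lemma exists_integral_sq_le_translate (hΩ : IsBoundedC11Domain Ω) :
    ∃ m : ℕ, ∀ u : V N → ℝ, MemLp u 2 volume → (∀ᵐ x, x ∉ Ω → u x = 0) → ∀ h : V N,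
      1 / 2 ≤ ‖h‖ → ∫ x, u x ^ 2 ≤ m ^ 2 * ∫ x, (u (h + x) - u x) ^ 2 := by
  obtain ⟨R, hR⟩ := hΩ.isBounded.subset_closedBall (0 : V N)
  -- With ‖h‖ ≥ 1/2 this gives m‖h‖ > 2R, so the translate by m·h moves every point of Ω out of Ω.
  obtain ⟨m, hm⟩ := exists_nat_gt (4 * R)
  refine ⟨m, fun u hu hu0 h hh => le_trans ?_ (integral_sq_translate_nsmul_le hu h m)⟩
  refine integral_mono_ae hu.integrable_sq ((memLp_translate hu _).sub hu).integrable_sq ?_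
  have h2 : ∀ᵐ x, m • h + x ∉ Ω → u (m • h + x) = 0 :=
    (measurePreserving_add_left volume (m • h)).quasiMeasurePreserving.ae hu0
  filter_upwards [hu0, h2] with x hx hx2
  by_cases hxΩ : x ∈ Ω
  · have : m • h + x ∉ Ω := by
      intro hmem
      have h3 : ‖m • h + x‖ ≤ R := by simpa using hR hmem
      have h4 : ‖x‖ ≤ R := by simpa using hR hxΩ
      have h5 : ‖m • h‖ ≤ ‖m • h + x‖ + ‖x‖ := by
        simpa using norm_sub_le (m • h + x) x
      have h6 : ‖m • h‖ = m * ‖h‖ := by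
        rw [← Nat.cast_smul_eq_nsmul ℝ, norm_smul]; simp
      have h7 : (m : ℝ) * (1 / 2) ≤ m * ‖h‖ := by gcongr
      linarith
    simp [hx2 this]
  · rw [hx hxΩ, zero_pow two_ne_zero]
    exact sq_nonneg _

lemma one_le_kerK {z : V N} (hz0 : z ≠ 0) (hz : ‖z‖ < 1) : 1 ≤ kerK z := by
  rw [kerK, indicator_of_mem (by simpa using hz)]
  have : 0 < ‖z‖ := norm_pos_iff.2 hz0
  rw [le_div_iff₀ (by positivity), one_mul]
  exact pow_le_one₀ this.le hz.le

/-- The translation bound is integrated over the shell 1/2 < |h| < 1, where k ≥ 1; the shear (h,x) ↦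
(h+x,x) turns the result into the energy. -/
lemma exists_poincare (hN : 1 ≤ N) (hΩ : IsBoundedC11Domain Ω) :
    ∃ C : ℝ, 0 ≤ C ∧ ∀ u ∈ energySpace Ω, ∫ x, u x ^ 2 ≤ C * normE u ^ 2 := by
  have : Nonempty (Fin N) := ⟨⟨0, hN⟩⟩
  obtain ⟨m, hm⟩ := exists_integral_sq_le_translate hΩ
  have hc := cN_pos hN
  set A : Set (V N) := Metric.ball 0 1 \ Metric.closedBall 0 (1 / 2) with hA
  have hAo : IsOpen A := Metric.isOpen_ball.sdiff Metric.isClosed_closedBall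
  have hAfin : volume A ≠ ⊤ :=
    ((measure_mono sdiff_subset).trans_lt measure_ball_lt_top).ne
  have hApos : 0 < volume.real A := by
    obtain ⟨z, hz⟩ := exists_norm_eq (V N) (c := 3 / 4) (by norm_num)
    refine ENNReal.toReal_pos (hAo.measure_pos volume ⟨z, ?_, ?_⟩).ne' hAfin
    · simp only [mem_ball_zero_iff, hz]; norm_num
    · simp only [mem_closedBall_zero_iff, hz]; norm_num
  refine ⟨m ^ 2 * (2 / cN N) / volume.real A, by positivity, fun u hu => ?_⟩
  have hdiff : diffForm kerK u u = 2 / cN N * normE u ^ 2 := by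
    have h0 : 0 ≤ diffForm kerK u u :=
      integral_nonneg fun p => mul_nonneg (mul_self_nonneg _) (kerK_nonneg _)
    have h1 : formE u u = cN N / 2 * diffForm kerK u u := rfl
    rw [normE, Real.sq_sqrt (h1 ▸ by positivity), h1]
    field_simp
  have hmp : MeasurePreserving (fun z : V N × V N => (z.1 + z.2, z.2)) (volume.prod volume)
      (volume.prod volume) := measurePreserving_add_prod volume volume
  have hint := integrable_diff hu hu
  have hint' : Integrable (fun p : V N × V N => (u (p.1 + p.2) - u p.2) ^ 2 * kerK p.1)
      (volume.prod volume) := by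
    refine (hmp.integrable_comp hint.1).2 hint |>.congr (Eventually.of_forall fun p => ?_)
    simp [pow_two]
  have heq : diffForm kerK u u = ∫ h, (∫ x, (u (h + x) - u x) ^ 2 * kerK h) := by
    rw [← integral_prod (fun p : V N × V N => (u (p.1 + p.2) - u p.2) ^ 2 * kerK p.1) hint',
      diffForm, ← hmp.map_eq, integral_map hmp.aemeasurable (hmp.map_eq.symm ▸ hint.1), hmp.map_eq]
    congr 1; ext p
    simp [pow_two]
  have hle : volume.real A * ∫ x, u x ^ 2 ≤ m ^ 2 * diffForm kerK u u := by
    have hI : Integrable (A.indicator fun _ => ∫ x, u x ^ 2) :=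
      (integrable_indicator_iff hAo.measurableSet).2 (integrableOn_const hAfin)
    have h1 : volume.real A * ∫ x, u x ^ 2 = ∫ h, A.indicator (fun _ => ∫ x, u x ^ 2) h := by
      rw [integral_indicator hAo.measurableSet]
      simp
    rw [heq, h1, ← integral_const_mul]
    refine integral_mono hI (hint'.integral_prod_left.const_mul _) fun h => ?_
    simp only
    rw [integral_mul_const]
    have hJ : 0 ≤ ∫ x, (u (h + x) - u x) ^ 2 := integral_nonneg fun x => sq_nonneg _
    by_cases hh : h ∈ A
    · rw [indicator_of_mem hh]
      have hh1 : ‖h‖ < 1 := by simpa using hh.1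
      have hh2 : 1 / 2 < ‖h‖ := by simpa using hh.2
      refine (hm u hu.1 hu.2.1 h hh2.le).trans ?_
      refine mul_le_mul_of_nonneg_left (le_mul_of_one_le_right hJ (one_le_kerK ?_ hh1))
        (by positivity)
      rw [← norm_pos_iff]; linarith
    · rw [indicator_of_notMem hh]
      exact mul_nonneg (by positivity) (mul_nonneg hJ (kerK_nonneg _))
  rw [hdiff] at hle
  rw [div_mul_eq_mul_div, le_div_iff₀ hApos]
  linarith

lemma exists_abs_formB_le (hN : 1 ≤ N) (hΩ : IsBoundedC11Domain Ω) :
    ∃ C : ℝ, 0 ≤ C ∧ ∀ u ∈ energySpace Ω, |formB Ω u u| ≤ C * normE u ^ 2 := by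
  obtain ⟨C, hC0, hC⟩ := exists_poincare hN hΩ
  have hc := cN_pos hN
  refine ⟨1 + (cN N * volume.real Ω + |rhoN N| + |lambda1 Ω|) * C, by positivity, fun u hu => ?_⟩
  have hu1 := integrable_of_mem hΩ hu.1 hu.2.1
  have h0 : 0 ≤ formE u u := mul_nonneg (by positivity)
    (integral_nonneg fun p => mul_nonneg (mul_self_nonneg _) (kerK_nonneg _))
  have h1 : formE u u = normE u ^ 2 := (Real.sq_sqrt h0).symm
  have h2 : |crossForm kerJ u u| ≤ volume.real Ω * ∫ x, u x ^ 2 := by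
    have h3 := abs_crossForm_le (κ := kerJ) (C := 1) abs_kerJ_le_one hu1 hu1
    have h4 := sq_integral_abs_le hu.1 hu1 hΩ.isOpen.measurableSet
      hΩ.isBounded.measure_lt_top.ne hu.2.1
    linarith
  have hI : 0 ≤ ∫ x, u x ^ 2 := integral_nonneg fun x => sq_nonneg _
  have h5 : formB Ω u u = formE u u + (-(cN N * crossForm kerJ u u)
      + (rhoN N * (∫ x, u x ^ 2) + -(lambda1 Ω * ∫ x, u x ^ 2))) := by
    simp only [formB, ← pow_two]
    change formE u u - cN N * crossForm kerJ u u + rhoN N * (∫ x, u x * u x) - _ = _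
    simp only [← pow_two]; ring
  have h6 : |formB Ω u u| ≤ formE u u + (cN N * |crossForm kerJ u u|
      + (|rhoN N| * (∫ x, u x ^ 2) + |lambda1 Ω| * ∫ x, u x ^ 2)) := by
    rw [h5]
    refine (abs_add_le _ _).trans (add_le_add (abs_of_nonneg h0).le ((abs_add_le _ _).trans
      (add_le_add ?_ ((abs_add_le _ _).trans (add_le_add ?_ ?_)))))
    · rw [abs_neg, abs_mul, abs_of_pos hc]
    · rw [abs_mul, abs_of_nonneg hI]
    · rw [abs_neg, abs_mul, abs_of_nonneg hI]
  have h7 := mul_le_mul_of_nonneg_left h2 hc.le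
  have h8 := mul_le_mul_of_nonneg_left (hC u hu)
    (show 0 ≤ cN N * volume.real Ω + |rhoN N| + |lambda1 Ω| by positivity)
  rw [← h1] at h8 ⊢
  linarith

/-! ### Positivity of first eigenfunctions -/

lemma formB_smul_left (hΩ : IsBoundedC11Domain Ω) {u v : V N → ℝ} (hu : u ∈ energySpace Ω)
    (hv : v ∈ energySpace Ω) (c : ℝ) : formB Ω (c • u) v = c * formB Ω u v := by
  have h := formB_add_smul hΩ zero_mem_energySpace hu hv c
  have h0 : formB Ω (0 : V N → ℝ) v = 0 := by
    simp [formB, formEL_eq, diffForm, crossForm]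
  rwa [zero_add, h0, zero_add] at h

lemma IsFirstEigenfunction.formB_eq_zero {φ v : V N → ℝ} (hφ : IsFirstEigenfunction Ω φ)
    (hv : v ∈ energySpace Ω) : formB Ω φ v = 0 := by
  rw [formB, hφ.2.1 v hv, setIntegral_mul_eq hv.2.1, sub_self]

/-- Let w = sψ - φ and let X be the interaction of w⁺ and w⁻. Testing with w⁺ and B(φ,·) = 0 give
B(w⁺,w⁺) + c_N X = s B(ψ,w⁺). Nonnegativity of B at w⁺ - (s/2)ψ absorbs the right side up to
s²/4·B(ψ,ψ). -/
lemma crossForm_posPart_le (hN : 1 ≤ N) (hΩ : IsBoundedC11Domain Ω) {φ ψ : V N → ℝ}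
    (hφ : IsFirstEigenfunction Ω φ) (hψ : ψ ∈ energySpace Ω) (s : ℝ) :
    cN N * crossForm kerT (posPart (s • ψ + (-1 : ℝ) • φ)) (posPart (-(s • ψ + (-1 : ℝ) • φ)))
      ≤ s ^ 2 / 4 * formB Ω ψ ψ := by
  set w := s • ψ + (-1 : ℝ) • φ with hw
  have hwH : w ∈ energySpace Ω := add_smul_mem (smul_mem hψ s) hφ.1.1 (-1)
  have hp := posPart_mem hwH
  have hm := posPart_mem (neg_mem hwH)
  have h1 : formB Ω w (posPart w) = s * formB Ω ψ (posPart w) := by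
    rw [hw, formB_add_smul hΩ (smul_mem hψ s) hφ.1.1 (hw ▸ hp), formB_smul_left hΩ hψ (hw ▸ hp),
      hφ.formB_eq_zero (hw ▸ hp)]
    ring
  have h2 := formB_add_smul hΩ hp hm hp (-1)
  rw [posPart_sub_posPart_neg, h1, formB_symm (posPart (-w)), formB_posPart hΩ hwH] at h2
  have h3 := formB_self_nonneg hN hΩ (add_smul_mem hp hψ (-(s / 2)))
  rw [formB_add_smul_self hΩ hp hψ, formB_symm _ ψ] at h3
  linarith

/-- A strong maximum principle. On {φ ≤ 0} one has (sψ-φ)⁺ ≥ sψ, so the interaction is at least of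
order s, while `crossForm_posPart_le` bounds it by order s². Letting s → 0 forces ψ·1_{φ≤0} = 0 or
(s₀ψ-φ)⁻ = 0. -/
lemma IsFirstEigenfunction.ae_pos (hN : 1 ≤ N) (hΩ : IsBoundedC11Domain Ω) {φ : V N → ℝ}
    (hφ : IsFirstEigenfunction Ω φ) : ∀ᵐ x, x ∈ Ω → 0 < φ x := by
  set ψ := distCompl Ω with hψd
  have hψ : ψ ∈ energySpace Ω := distCompl_mem hN hΩ
  have hψ0 : ∀ x, 0 ≤ ψ x := distCompl_nonneg
  have hc := cN_pos hN
  have hφH := hφ.1.1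
  set f : V N → ℝ := {x | φ x ≤ 0}.indicator ψ with hf
  have hf0 : ∀ x, 0 ≤ f x := fun x => indicator_nonneg (fun y _ => hψ0 y) x
  have hfm : AEStronglyMeasurable f volume := hψ.1.1.indicator₀
    (nullMeasurableSet_le hφH.1.1.aemeasurable aemeasurable_const)
  suffices h : f =ᵐ[volume] 0 by
    filter_upwards [h] with x hx hxΩ
    by_contra hcon
    rw [hf, indicator_of_mem (show x ∈ {x | φ x ≤ 0} from not_lt.1 hcon)] at hx
    exact (distCompl_pos hN hΩ hxΩ).ne' hx
  have hor : ∀ s₀ : ℝ, 0 < s₀ → f =ᵐ[volume] 0 ∨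
      posPart (-(s₀ • ψ + (-1 : ℝ) • φ)) =ᵐ[volume] 0 := by
    intro s₀ hs₀
    set g := posPart (-(s₀ • ψ + (-1 : ℝ) • φ)) with hg
    have hw : ∀ s : ℝ, s • ψ + (-1 : ℝ) • φ ∈ energySpace Ω := fun s =>
      add_smul_mem (smul_mem hψ s) hφH (-1)
    have hgm : AEStronglyMeasurable g volume := (posPart_mem (neg_mem (hw s₀))).1.1
    have hle : ∀ s : ℝ, 0 < s → s ≤ s₀ → ∀ p : V N × V N,
        s * (f p.1 * g p.2 * kerT (p.1 - p.2)) ≤ posPart (s • ψ + (-1 : ℝ) • φ) p.1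
          * posPart (-(s • ψ + (-1 : ℝ) • φ)) p.2 * kerT (p.1 - p.2) := by
      intro s hs hss p
      have h1 : s * f p.1 ≤ posPart (s • ψ + (-1 : ℝ) • φ) p.1 := by
        by_cases hp : φ p.1 ≤ 0
        · rw [hf, indicator_of_mem (show p.1 ∈ {x | φ x ≤ 0} from hp)]
          refine le_trans ?_ (le_max_left _ _)
          simp only [Pi.add_apply, Pi.smul_apply, smul_eq_mul]
          linarith
        · rw [hf, indicator_of_notMem (show p.1 ∉ {x | φ x ≤ 0} from hp), mul_zero]
          exact posPart_nonneg _ _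
      have h2 : g p.2 ≤ posPart (-(s • ψ + (-1 : ℝ) • φ)) p.2 := by
        refine max_le_max_right _ ?_
        simp only [Pi.neg_apply, Pi.add_apply, Pi.smul_apply, smul_eq_mul]
        nlinarith [mul_le_mul_of_nonneg_right hss (hψ0 p.2)]
      rw [← mul_assoc, ← mul_assoc]
      refine mul_le_mul_of_nonneg_right ?_ (kerT_nonneg _)
      exact mul_le_mul h1 h2 (posPart_nonneg _ _) (posPart_nonneg _ _)
    have hint : ∀ s : ℝ, Integrable (fun p : V N × V N => posPart (s • ψ + (-1 : ℝ) • φ) p.1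
        * posPart (-(s • ψ + (-1 : ℝ) • φ)) p.2 * kerT (p.1 - p.2)) (volume.prod volume) :=
      fun s => integrable_cross_kerT hΩ (posPart_mem (hw s)) (posPart_mem (neg_mem (hw s)))
        (posPart_nonneg _) (posPart_nonneg _) (posPart_mul_posPart_neg _)
    have hfg : Integrable (fun p : V N × V N => f p.1 * g p.2 * kerT (p.1 - p.2))
        (volume.prod volume) := by
      refine ((hint s₀).const_mul s₀⁻¹).mono' (aestronglyMeasurable_cross measurable_kerT hfm hgm)
        (Eventually.of_forall fun p => ?_)
      have h0 : 0 ≤ f p.1 * g p.2 * kerT (p.1 - p.2) :=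
        mul_nonneg (mul_nonneg (hf0 _) (posPart_nonneg _ _)) (kerT_nonneg _)
      rw [Real.norm_eq_abs, abs_of_nonneg h0, inv_mul_eq_div, le_div_iff₀ hs₀, mul_comm]
      exact hle s₀ hs₀ le_rfl p
    have hX0 : 0 ≤ crossForm kerT f g := crossForm_nonneg kerT_nonneg hf0 (posPart_nonneg _)
    refine ae_eq_zero_or_of_crossForm_eq_zero hN hf0 (posPart_nonneg _) hfg ?_
    have hB := formB_self_nonneg hN hΩ hψ
    -- The functions f and g do not depend on s; dividing the s² bound by s leaves a factor that
    -- tends to 0.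
    have hup : ∀ s : ℝ, 0 < s → s ≤ s₀ → cN N * crossForm kerT f g ≤ s * (formB Ω ψ ψ / 4) := by
      intro s hs hss
      have h1 : s * crossForm kerT f g ≤ crossForm kerT (posPart (s • ψ + (-1 : ℝ) • φ))
          (posPart (-(s • ψ + (-1 : ℝ) • φ))) := by
        unfold crossForm
        rw [← integral_const_mul]
        exact integral_mono (hfg.const_mul s) (hint s) (hle s hs hss)
      have h2 := crossForm_posPart_le hN hΩ hφ hψ s
      have h3 := (mul_le_mul_of_nonneg_left h1 hc.le).trans h2
      refine le_of_mul_le_mul_left ?_ hs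
      linarith
    have h5 : cN N * crossForm kerT f g ≤ 0 := by
      refine ge_of_tendsto (x := 𝓝[>] (0 : ℝ)) (f := fun s : ℝ => s * (formB Ω ψ ψ / 4)) ?_ ?_
      · have : Tendsto (fun s : ℝ => s * (formB Ω ψ ψ / 4)) (𝓝 0) (𝓝 (0 * (formB Ω ψ ψ / 4))) :=
          tendsto_id.mul_const _
        rw [zero_mul] at this
        exact this.mono_left nhdsWithin_le_nhds
      · filter_upwards [Ioc_mem_nhdsGT hs₀] with s hs
        exact hup s hs.1 hs.2
    nlinarith
  by_contra hcon
  -- If {φ ≤ 0} ∩ Ω is not null, then φ ≤ s₀ψ for every s₀ > 0, so φ = 0, against the normalization.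
  have hall : ∀ n : ℕ, ∀ᵐ x, φ x ≤ 1 / ((n : ℝ) + 1) * ψ x := by
    intro n
    have h1 := (hor (1 / ((n : ℝ) + 1)) (by positivity)).resolve_left hcon
    filter_upwards [h1] with x hx
    have : -(1 / ((n : ℝ) + 1) * ψ x + -1 * φ x) ≤ 0 := by
      simpa only [posPart, Pi.neg_apply, Pi.add_apply, Pi.smul_apply, smul_eq_mul, Pi.zero_apply,
        max_eq_right_iff] using hx
    linarith
  have hz : φ =ᵐ[volume] 0 := by
    filter_upwards [ae_all_iff.2 hall, hφ.2.2] with x hx hx0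
    refine le_antisymm ?_ hx0
    have h1 : Tendsto (fun n : ℕ => 1 / ((n : ℝ) + 1) * ψ x) atTop (𝓝 (0 * ψ x)) :=
      tendsto_one_div_add_atTop_nhds_zero_nat.mul_const _
    rw [zero_mul] at h1
    exact ge_of_tendsto' h1 hx
  have h1 := hφ.1.2
  rw [massI_eq hφH.2.1, integral_congr_ae (g := fun _ => (0 : ℝ))] at h1
  · simp at h1
  · filter_upwards [hz] with x hx
    simp [hx]

/-! ### Simplicity -/

lemma IsFirstEigenfunction.formB_add_smul (hΩ : IsBoundedC11Domain Ω) {φ v : V N → ℝ}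
    (hφ : IsFirstEigenfunction Ω φ) (hv : v ∈ energySpace Ω) (c : ℝ) :
    formB Ω (v + c • φ) (v + c • φ) = formB Ω v v := by
  rw [formB_add_smul_self hΩ hv hφ.1.1, formB_symm v φ, hφ.formB_eq_zero hv,
    hφ.formB_eq_zero hφ.1.1]
  ring

lemma ae_eq_of_le_of_integral_sq_eq {u v : V N → ℝ} (hu : MemLp u 2 volume)
    (hv : MemLp v 2 volume) (hu0 : ∀ᵐ x, 0 ≤ u x) (hle : ∀ᵐ x, u x ≤ v x)
    (h : ∫ x, u x ^ 2 = ∫ x, v x ^ 2) : u =ᵐ[volume] v := by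
  have hsq : (fun x => u x ^ 2) ≤ᵐ[volume] fun x => v x ^ 2 := by
    filter_upwards [hu0, hle] with x h1 h2
    exact pow_le_pow_left₀ h1 h2 2
  have := (integral_eq_iff_of_ae_le hu.integrable_sq hv.integrable_sq hsq).1 h
  filter_upwards [this, hu0, hle] with x h1 h2 h3
  exact (pow_left_inj₀ h2 (h2.trans h3) two_ne_zero).1 h1

/-- A nonnegative minimizer is equal to every first eigenfunction. -/
lemma IsFirstEigenfunction.ae_eq_of_formB_eq_zero (hN : 1 ≤ N) (hΩ : IsBoundedC11Domain Ω)
    {φ u : V N → ℝ} (hφ : IsFirstEigenfunction Ω φ) (hu : u ∈ sphereP Ω) (hu0 : ∀ᵐ x, 0 ≤ u x)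
    (h : formB Ω u u = 0) : u =ᵐ[volume] φ := by
  have hφ1 := hφ.1.2
  have hu1 := hu.2
  rw [massI_eq hφ.1.1.2.1] at hφ1
  rw [massI_eq hu.1.2.1] at hu1
  have hd := hφ.formB_add_smul hΩ hu.1 (-1)
  rw [h] at hd
  -- The difference u - φ is again a zero of B, so u and φ are ordered; equal L² norms then force
  -- equality.
  rcases posPart_eq_zero_or hN hΩ (add_smul_mem hu.1 hφ.1.1 (-1)) hd with h0 | h0
  · refine ae_eq_of_le_of_integral_sq_eq hu.1.1 hφ.1.1.1 hu0 ?_ (hu1.trans hφ1.symm)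
    filter_upwards [h0] with x hx
    simp only [posPart, Pi.add_apply, Pi.smul_apply, smul_eq_mul, Pi.zero_apply,
      max_eq_right_iff] at hx
    linarith
  · refine (ae_eq_of_le_of_integral_sq_eq hφ.1.1.1 hu.1.1 hφ.2.2 ?_ (hφ1.trans hu1.symm)).symm
    filter_upwards [h0] with x hx
    simp only [posPart, Pi.neg_apply, Pi.add_apply, Pi.smul_apply, smul_eq_mul, Pi.zero_apply,
      max_eq_right_iff] at hx
    linarith

/-! ### The energy near `-φ` -/

lemma energyE_eq (r : ℝ) {w : V N → ℝ} (hw : w ∈ energySpace Ω) :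
    energyE Ω r w = formEL w w - r * ∫ x, posPart w x ^ 2 := by
  have := massI_eq (posPart_mem hw).2.1
  rw [energyE, ← this]; rfl

lemma neg_mem_sphereP {u : V N → ℝ} (hu : u ∈ sphereP Ω) : -u ∈ sphereP Ω :=
  ⟨neg_mem hu.1, by rw [← hu.2]; simp [massI]⟩

lemma IsFirstEigenfunction.posPart_neg {φ : V N → ℝ} (hφ : IsFirstEigenfunction Ω φ) :
    posPart (-φ) =ᵐ[volume] 0 := by
  filter_upwards [hφ.2.2] with x hx
  simpa [posPart] using hx

lemma IsFirstEigenfunction.energyE_neg {φ : V N → ℝ} (hφ : IsFirstEigenfunction Ω φ) (r : ℝ) :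
    energyE Ω r (-φ) = lambda1 Ω := by
  have h1 : ∫ x, posPart (-φ) x ^ 2 = 0 := by
    rw [integral_congr_ae (g := fun _ => (0 : ℝ))]
    · simp
    · filter_upwards [hφ.posPart_neg] with x hx
      simp [hx]
  have h2 := formB_self_eq hφ.1
  rw [hφ.formB_eq_zero hφ.1.1] at h2
  have h3 : formEL (-φ) (-φ) = formEL φ φ := by
    simpa using formEL_smul_smul (-1) φ
  rw [energyE_eq r (neg_mem hφ.1.1), h1, h3]
  linarith

/-- With multiplier λ₁ the increment in direction v is B(v,v) - r∫((v-φ)⁺)². Both terms are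
quadratic in the norm of v, by `exists_abs_formB_le` and by (v-φ)⁺ ≤ |v| with Poincaré. -/
lemma IsFirstEigenfunction.isCriticalPoint (hN : 1 ≤ N) (hΩ : IsBoundedC11Domain Ω)
    {φ : V N → ℝ} (hφ : IsFirstEigenfunction Ω φ) (r : ℝ) : IsCriticalPoint Ω r (-φ) := by
  refine ⟨neg_mem_sphereP hφ.1, lambda1 Ω, fun ε hε => ?_⟩
  obtain ⟨C, hC0, hC⟩ := exists_poincare hN hΩ
  obtain ⟨D, hD0, hD⟩ := exists_abs_formB_le hN hΩ
  have hK : 0 < D + |r| * C + 1 := by positivity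
  refine ⟨ε / (D + |r| * C + 1), by positivity, fun v hv hvlt => ?_⟩
  have hwH : -φ + v ∈ energySpace Ω := by
    have := add_smul_mem (neg_mem hφ.1.1) hv 1
    rwa [one_smul] at this
  have h1 : energyE Ω r (-φ + v) - lambda1 Ω * massI Ω (-φ + v)
      = formB Ω v v - r * ∫ x, posPart (-φ + v) x ^ 2 := by
    have h2 := hφ.formB_add_smul hΩ hv (-1)
    have h3 : v + (-1 : ℝ) • φ = -φ + v := by simp [add_comm]
    rw [h3] at h2
    rw [energyE_eq r hwH, massI_eq hwH.2.1, ← h2]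
    simp only [formB, ← pow_two]; ring
  have h4 : energyE Ω r (-φ) - lambda1 Ω * massI Ω (-φ) = 0 := by
    rw [hφ.energyE_neg, (neg_mem_sphereP hφ.1).2]; ring
  have h5 : ∫ x, posPart (-φ + v) x ^ 2 ≤ ∫ x, v x ^ 2 := by
    refine integral_mono_ae (memLp_posPart hwH.1).integrable_sq hv.1.integrable_sq ?_
    filter_upwards [hφ.2.2] with x hx
    rw [← sq_abs (v x)]
    refine pow_le_pow_left₀ (posPart_nonneg _ _) (max_le ?_ (abs_nonneg _)) 2
    simp only [Pi.add_apply, Pi.neg_apply]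
    linarith [le_abs_self (v x)]
  have h6 : 0 ≤ ∫ x, posPart (-φ + v) x ^ 2 := integral_nonneg fun x => sq_nonneg _
  have hn : 0 ≤ normE v := Real.sqrt_nonneg _
  simp only [h1, h4, sub_zero]
  calc |formB Ω v v - r * ∫ x, posPart (-φ + v) x ^ 2|
      ≤ |formB Ω v v| + |r * ∫ x, posPart (-φ + v) x ^ 2| := abs_sub _ _
    _ ≤ D * normE v ^ 2 + |r| * (C * normE v ^ 2) := by
        rw [abs_mul, abs_of_nonneg h6]
        gcongr
        · exact hD v hv
        · exact h5.trans (hC v hv)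
    _ ≤ ((D + |r| * C + 1) * normE v) * normE v := by nlinarith [sq_nonneg (normE v)]
    _ ≤ ε * normE v := by
        rw [lt_div_iff₀ hK] at hvlt
        gcongr
        linarith

/-- Continuity from above: the sublevel sets have finite measure and decrease to a null set. -/
lemma exists_measure_sublevel_le (hΩ : IsBoundedC11Domain Ω) {φ : V N → ℝ}
    (hφm : AEStronglyMeasurable φ volume) (hpos : ∀ᵐ x, x ∈ Ω → 0 < φ x) {η : ℝ} (hη : 0 < η) :
    ∃ t : ℝ, 0 < t ∧ volume.real {x | x ∈ Ω ∧ φ x ≤ t} ≤ η := by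
  have hfin : ∀ s : Set (V N), s ⊆ Ω → volume s ≠ ⊤ := fun s hs =>
    ((measure_mono hs).trans_lt hΩ.isBounded.measure_lt_top).ne
  set S : ℕ → Set (V N) := fun n => {x | x ∈ Ω ∧ φ x ≤ 1 / ((n : ℝ) + 1)} with hS
  have hanti : Antitone S := fun m n hmn x hx =>
    ⟨hx.1, hx.2.trans (one_div_le_one_div_of_le (by positivity) (by gcongr))⟩
  have hlim := tendsto_measure_iInter_atTop (μ := volume) (s := S)
    (fun n => hΩ.isOpen.measurableSet.nullMeasurableSet.inter
      (nullMeasurableSet_le hφm.aemeasurable aemeasurable_const)) hanti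
    ⟨0, hfin _ fun x hx => hx.1⟩
  have hzero : volume (⋂ n, S n) = 0 := by
    refine measure_mono_null (fun x hx => ?_) hpos
    rw [mem_iInter] at hx
    have h1 : φ x ≤ 0 := ge_of_tendsto' tendsto_one_div_add_atTop_nhds_zero_nat fun n => (hx n).2
    exact fun hcon => (hcon (hx 0).1).not_ge h1
  rw [hzero] at hlim
  obtain ⟨n, hn⟩ := (hlim.eventually_lt_const (ENNReal.ofReal_pos.2 hη)).exists
  exact ⟨1 / ((n : ℝ) + 1), by positivity, ENNReal.toReal_le_of_le_ofReal hη.le hn.le⟩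

/-- Functions close to `-φ` are positive on a small set only. -/
lemma IsFirstEigenfunction.exists_measure_pos_le (hN : 1 ≤ N) (hΩ : IsBoundedC11Domain Ω)
    {φ : V N → ℝ} (hφ : IsFirstEigenfunction Ω φ) {η : ℝ} (hη : 0 < η) :
    ∃ ε : ℝ, 0 < ε ∧ ∀ w ∈ energySpace Ω, normE (w - -φ) < ε →
      volume.real {x | x ∈ Ω ∧ 0 < w x} ≤ η := by
  obtain ⟨t, ht, hvol⟩ := exists_measure_sublevel_le hΩ hφ.1.1.1.1 (hφ.ae_pos hN hΩ) (half_pos hη)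
  obtain ⟨C, hC0, hC⟩ := exists_poincare hN hΩ
  -- Where w > 0 and φ > t, the difference w + φ exceeds t. By Chebyshev and Poincaré this ε limits
  -- that set to measure η/2, the other half being {φ ≤ t}. The summand 1 in C + 1 keeps the divisor
  -- positive.
  refine ⟨Real.sqrt (t ^ 2 * (η / 2) / (C + 1)), Real.sqrt_pos.2 (by positivity),
    fun w hw hlt => ?_⟩
  have hdH := sub_mem hw (neg_mem hφ.1.1)
  set d := w - -φ with hd
  have hn : 0 ≤ normE d := Real.sqrt_nonneg _
  have h1 : normE d ^ 2 < t ^ 2 * (η / 2) / (C + 1) := (Real.lt_sqrt hn).1 hlt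
  rw [lt_div_iff₀ (by positivity)] at h1
  have h2 : t ^ 2 * volume.real {x | t ^ 2 ≤ d x ^ 2} ≤ ∫ x, d x ^ 2 :=
    mul_meas_ge_le_integral_of_nonneg (Eventually.of_forall fun x => sq_nonneg _)
      hdH.1.integrable_sq _
  have h3 := hC d hdH
  have h4 : volume.real {x | t ^ 2 ≤ d x ^ 2} ≤ η / 2 := by
    refine le_of_mul_le_mul_left ?_ (show 0 < t ^ 2 by positivity)
    nlinarith [sq_nonneg (normE d)]
  have hsub : {x | x ∈ Ω ∧ 0 < w x} ⊆ {x | x ∈ Ω ∧ φ x ≤ t} ∪ {x | t ^ 2 ≤ d x ^ 2} := by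
    rintro x ⟨hxΩ, hwx⟩
    by_cases hx : φ x ≤ t
    · exact Or.inl ⟨hxΩ, hx⟩
    · right
      have : t ≤ d x := by
        simp only [hd, Pi.sub_apply, Pi.neg_apply]; linarith
      exact pow_le_pow_left₀ ht.le this 2
  have hfin1 : volume {x | x ∈ Ω ∧ φ x ≤ t} ≠ ⊤ :=
    ((measure_mono fun x hx => hx.1).trans_lt hΩ.isBounded.measure_lt_top).ne
  have hfin2 : volume {x | t ^ 2 ≤ d x ^ 2} ≠ ⊤ :=
    (hdH.1.integrable_sq.measure_ge_lt_top (by positivity)).ne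
  have h5 := measureReal_mono (μ := volume) hsub (measure_union_lt_top hfin1.lt_top hfin2.lt_top).ne
  have h6 := measureReal_union_le (μ := volume) {x | x ∈ Ω ∧ φ x ≤ t} {x | t ^ 2 ≤ d x ^ 2}
  linarith

lemma IsFirstEigenfunction.isStrictLocalMinimum (hN : 1 ≤ N) (hΩ : IsBoundedC11Domain Ω)
    {φ : V N → ℝ} (hφ : IsFirstEigenfunction Ω φ) (r : ℝ) : IsStrictLocalMinimum Ω r (-φ) := by
  -- The constant absorbs both λ₁ and r and leaves a full ∫(w⁺)² as strict gain.
  obtain ⟨η, hη, hcoer⟩ := exists_small_support_coercive hN hΩ (lambda1 Ω + |r| + 1)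
  obtain ⟨ε, hε, hsmall⟩ := hφ.exists_measure_pos_le hN hΩ hη
  refine ⟨neg_mem_sphereP hφ.1, ε, hε, fun w hw hwε hne => ?_⟩
  rw [hφ.energyE_neg, energyE_eq r hw.1]
  have hp := posPart_mem hw.1
  have hm := posPart_mem (neg_mem hw.1)
  have hBw := formB_self_eq hw
  by_cases hw0 : posPart w =ᵐ[volume] 0
  · have hz : ∫ x, posPart w x ^ 2 = 0 := by
      rw [integral_congr_ae (g := fun _ => (0 : ℝ))]
      · simp
      · filter_upwards [hw0] with x hx
        simp [hx]
    rw [hz, mul_zero, sub_zero]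
    have h0 := formB_self_nonneg hN hΩ hw.1
    by_contra hcon
    have hB0 : formB Ω w w = 0 := by linarith
    have hneg : formB Ω (-w) (-w) = 0 := by
      have h1 := formB_self_eq (neg_mem_sphereP hw)
      have h2 : formEL (-w) (-w) = formEL w w := by simpa using formEL_smul_smul (-1) w
      rw [h1, h2, ← hBw, hB0]
    have h3 := hφ.ae_eq_of_formB_eq_zero hN hΩ (neg_mem_sphereP hw) (by
      filter_upwards [hw0] with x hx
      simpa [posPart] using hx) hneg
    refine hne ?_
    filter_upwards [h3] with x hx
    simp only [Pi.neg_apply] at hx ⊢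
    linarith
  · have hI := integral_sq_pos hp.1 hw0
    have hfin : volume {x | x ∈ Ω ∧ 0 < w x} ≠ ⊤ :=
      ((measure_mono fun x hx => hx.1).trans_lt hΩ.isBounded.measure_lt_top).ne
    -- The representative w is only a.e. measurable, so {w > 0} is replaced by a measurable hull of
    -- equal measure.
    have hA := hcoer (posPart w) hp (toMeasurable volume {x | x ∈ Ω ∧ 0 < w x})
      (measurableSet_toMeasurable _ _) (by rwa [measure_toMeasurable])
      (by rw [measureReal_def, measure_toMeasurable]; exact hsmall w hw.1 hwε) (by
        filter_upwards [hp.2.1] with x hx hxA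
        by_cases hxΩ : x ∈ Ω
        · have : ¬ 0 < w x := fun h => hxA (subset_toMeasurable _ _ ⟨hxΩ, h⟩)
          exact max_eq_right (not_lt.1 this)
        · exact hx hxΩ)
    have h1 := formB_self_eq_posPart hΩ hw.1
    have h2 := formB_self_nonneg hN hΩ hm
    have h3 : 0 ≤ cN N * crossForm kerT (posPart w) (posPart (-w)) :=
      mul_nonneg (cN_pos hN).le
        (crossForm_nonneg kerT_nonneg (posPart_nonneg _) (posPart_nonneg _))
    have h4 : formB Ω (posPart w) (posPart w)
        = formEL (posPart w) (posPart w) - lambda1 Ω * ∫ x, posPart w x ^ 2 := by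
      simp only [formB, ← pow_two]
    have h5 := mul_le_mul_of_nonneg_right (le_abs_self r) hI.le
    linarith

/-! ### Nontriviality of -φ and the Fučík line -/

lemma IsFirstEigenfunction.neg_not_ae_eq {φ : V N → ℝ} (hφ : IsFirstEigenfunction Ω φ) :
    ¬ (-φ =ᵐ[volume] φ) := by
  intro h
  have h1 := hφ.1.2
  rw [massI_eq hφ.1.1.2.1, integral_congr_ae (g := fun _ => (0 : ℝ))] at h1
  · simp at h1
  · filter_upwards [h] with x hx
    have : φ x = 0 := by
      simp only [Pi.neg_apply] at hx
      linarith
    simp [this]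

lemma IsFirstEigenfunction.mem_fucikSpectrum (hΩ : IsBoundedC11Domain Ω) {φ : V N → ℝ}
    (hφ : IsFirstEigenfunction Ω φ) (r : ℝ) :
    (lambda1 Ω + r, lambda1 Ω) ∈ fucikSpectrum Ω := by
  refine ⟨-φ, ⟨neg_mem hφ.1.1, fun v hv => ?_⟩, fun h => hφ.neg_not_ae_eq ?_⟩
  · have h1 : formEL (-φ) v = -formEL φ v := by
      have h := formEL_add_smul hΩ (neg_mem hφ.1.1) hφ.1.1 hv 1
      have h0 : formEL (0 : V N → ℝ) v = 0 := by simp [formEL_eq, diffForm, crossForm]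
      rw [one_smul, neg_add_cancel, h0] at h
      linarith
    have h2 : ∫ x in Ω, max ((-φ) x) 0 * v x = 0 := by
      rw [setIntegral_congr_ae₀ (g := fun _ => (0 : ℝ)) hΩ.isOpen.measurableSet.nullMeasurableSet]
      · simp
      · filter_upwards [hφ.posPart_neg] with x hx _
        change posPart (-φ) x * v x = 0
        simp [hx]
    have h3 : ∫ x in Ω, max (-(-φ) x) 0 * v x = ∫ x in Ω, φ x * v x := by
      refine setIntegral_congr_ae₀ hΩ.isOpen.measurableSet.nullMeasurableSet ?_
      filter_upwards [hφ.2.2] with x hx _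
      simp [hx]
    simp only [h1, h2, h3, hφ.2.1 v hv]; ring
  · filter_upwards [h] with x hx
    simp only [Pi.neg_apply, Pi.zero_apply] at hx ⊢
    linarith

end LogLaplacian

theorem mainTheorem9 (N : ℕ) (hN : 1 ≤ N) (Ω : Set (EuclideanSpace ℝ (Fin N)))
    (hΩ : LogLaplacian.IsBoundedC11Domain Ω) :
    (∃ φ₁, LogLaplacian.IsFirstEigenfunction Ω φ₁) ∧
    (∀ φ₁, LogLaplacian.IsFirstEigenfunction Ω φ₁ → ∀ r : ℝ,
      LogLaplacian.IsCriticalPoint Ω r (-φ₁) ∧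
      ¬ (-φ₁ =ᵐ[volume] φ₁) ∧
      LogLaplacian.IsStrictLocalMinimum Ω r (-φ₁) ∧
      LogLaplacian.energyE Ω r (-φ₁) = LogLaplacian.lambda1 Ω) ∧
    (∀ r : ℝ,
      (LogLaplacian.lambda1 Ω + r, LogLaplacian.lambda1 Ω) ∈ LogLaplacian.fucikSpectrum Ω) := by
  refine ⟨LogLaplacian.exists_isFirstEigenfunction hN hΩ, fun φ hφ r => ⟨hφ.isCriticalPoint hN hΩ r,
    hφ.neg_not_ae_eq, hφ.isStrictLocalMinimum hN hΩ r, hφ.energyE_neg r⟩, fun r => ?_⟩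
  obtain ⟨φ, hφ⟩ := LogLaplacian.exists_isFirstEigenfunction hN hΩ
  exact hφ.mem_fucikSpectrum hΩ r
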